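/- **Setting.** Let \(\Omega\) be the set of counting paths: maps \(\omega\colon\mathbb{R}_{\ge 0}\to\mathbb{Z}_{\ge 0}\) with \(\omega(0)=0\) that are nondecreasing, right-continuous and have unit jumps. Let \(N_t(\omega)=\omega(t)\). A *stopping time* is a map \(\tau\colon\Omega\to[0,+\infty]\) such that \(\tau(\omega_1)=\tau(\omega_2)\) whenever \(\omega_1,\omega_2\) agree on \([0,\tau(\omega_1)]\cap\mathbb{R}_{\ge0}\). A real function \(h\) on a set \(D\subseteq\Omega\) is *\(\tau\)-measurable* if \(h(\omega_1)=h(\omega_2)\) whenever \(\omega_1,\omega_2\in D\) agree on \([0,\tau(\omega_1)]\cap\mathbb{R}_{\ge0}\). Fix rate bounds \(0\le\underline\lambda\le\overline\lambda<+\infty\). A *one-sided elementary trading strategy* \(G\) consists of finitely many stopping times \(\tau_1\le\dots\le\tau_{n+1}\) and, for \(k=1,\dots,n\), bounded nonnegative \(\tau_k\)-measurable real stakes \(\overline h_k,\underline h_k\) whose domain includes \(\{\tau_k<+\infty\}\). With initial capital \(c\in\mathbb{R}\) its capital process is \[ K^{G,c}_t=c+\sum_{k=1}^n \overline h_k\bigl(N_{\tau_{k+1}\wedge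 t}-N_{\tau_k\wedge t}-\overline\lambda(\tau_{k+1}\wedge t-\tau_k\wedge t)\bigr)+\underline h_k\bigl(\underline\lambda(\tau_{k+1}\wedge t-\tau_k\wedge t)-N_{\tau_{k+1}\wedge t}+N_{\tau_k\wedge t}\bigr), \] where terms with \(\tau_k\wedge t=\tau_{k+1}\wedge t\) are zero. For \(s\in\mathbb{R}_{\ge0}\), \(f\colon\Omega\to\overline{\mathbb{R}}\) and \(\omega\in\Omega\), the game-theoretic conditional upper expectation \(\overline{\mathrm E}[f|s](\omega)\) is the infimum (in \(\overline{\mathbb{R}}\)) of \(K^{G,c}_s(\omega)\) over all \(G,c\) for which \(\inf_{t,\varpi}K^{G,c}_t(\varpi)>-\infty\) and \(\liminf_{t\to+\infty}K^{G,c}_t(\varpi)\ge f(\varpi)\) for every \(\varpi\in\Omega\) that agrees with \(\omega\) on \([0,s]\). Let \(\mathcal{B}\) be the set of bounded functions \(g\colon\mathbb{Z}_{\ge0}\to\mathbb{R}\), with the supremum norm, and define \(\overline{\mathrm G}\colon\mathcal B\to\mathcal B\) by \[(\overline{\mathrm G}g)(n)=\max\{\lambda\,(g(n+1)-g(n))\colon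 \lambda\in\{\underline\lambda,\overline\lambda\}\}.\] **Theorem.** For every \(\Delta\ge0\) the limit \[\overline{\mathrm S}_\Delta=e^{\Delta\overline{\mathrm G}}=\lim_{k\to+\infty}\Bigl(\mathrm I+\tfrac{\Delta}{k}\overline{\mathrm G}\Bigr)^k\] exists in operator norm (that is, uniformly on bounded subsets of \(\mathcal B\)), and for all \(s,t\in\mathbb{R}_{\ge0}\) with \(s\le t\), all \(g\in\mathcal B\) and all \(\omega\in\Omega\), \[ \overline{\mathrm E}[g(N_t)|s](\omega)=\bigl(\overline{\mathrm S}_{t-s}\,g\bigr)(\omega(s)). \] -/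

import Mathlib

open Filter Topology
open scoped NNReal ENNReal BoundedContinuousFunction

namespace ImprecisePoisson

/-- Counting paths `ω : ℝ≥0 → ℤ≥0`: they start in `0`, are increasing (i.e. nondecreasing) and
right-continuous, and have unit jumps. As `ω` is nondecreasing and integer valued, its left limit
at `t` is the value of `ω` just before `t`, so unit jumps means that `ω t ≤ ω s + 1`
for all `s < t` close to `t`. -/
structure CountingPath where
  toFun : ℝ≥0 → ℕ
  map_zero' : toFun 0 = 0
  monotone' : Monotone toFun
  rightContinuous' : ∀ t, ContinuousWithinAt toFun (Set.Ici t) t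
  unitJumps' : ∀ t, ∀ᶠ s in 𝓝[<] t, toFun t ≤ toFun s + 1

instance : CoeFun CountingPath (fun _ => ℝ≥0 → ℕ) := ⟨CountingPath.toFun⟩

/-- The coordinate variable `N_t : ω ↦ ω(t)`. -/
def coord (t : ℝ≥0) (ω : CountingPath) : ℕ := ω t

/-- `ω₁` and `ω₂` agree on `[0, a] ∩ ℝ≥0`, where `a` may be `+∞`. -/
def AgreeUpTo (a : ℝ≥0∞) (ω₁ ω₂ : CountingPath) : Prop :=
  ∀ r : ℝ≥0, (r : ℝ≥0∞) ≤ a → ω₁ r = ω₂ r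

/-- Stopping times, with values in `[0, +∞]`. -/
def IsStoppingTime (τ : CountingPath → ℝ≥0∞) : Prop :=
  ∀ ω₁ ω₂, AgreeUpTo (τ ω₁) ω₁ ω₂ → τ ω₁ = τ ω₂

/-- The set of counting paths that agree with `ω` on `[0, τ(ω)] ∩ ℝ≥0`. -/
def toStop (τ : CountingPath → ℝ≥0∞) (ω : CountingPath) : Set CountingPath :=
  {ϖ | AgreeUpTo (τ ω) ϖ ω}

/-- `τ`-measurability of a partial variable with domain `D`
(a partial variable is a function whose values outside its domain are ignored). -/
def MeasurableAt {α : Type*} (τ : CountingPath → ℝ≥0∞) (D : Set CountingPath)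
    (f : CountingPath → α) : Prop :=
  ∀ ω₁ ∈ D, ∀ ω₂ ∈ D, AgreeUpTo (τ ω₁) ω₁ ω₂ → f ω₁ = f ω₂

/-- A family of real variables indexed by time is bounded below. -/
def BoundedBelow (K : ℝ≥0 → CountingPath → ℝ) : Prop :=
  ∃ B : ℝ, ∀ t ω, B ≤ K t ω

/-- The game-theoretic conditional upper expectation `E̅[f | τ](ω)`, for a path `ω` with
`τ(ω) < +∞`, that corresponds to the set `𝒦` of allowed capital processes: the infimum of the
capital `K_τ(ω)` over all bounded below `K` in `𝒦` whose limit inferior dominates `f` on all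
paths that agree with `ω` up to time `τ(ω)`. The infimum is taken in the extended reals. -/
noncomputable def upperExpectation (𝒦 : Set (ℝ≥0 → CountingPath → ℝ))
    (τ : CountingPath → ℝ≥0∞) (f : CountingPath → EReal) (ω : CountingPath) : EReal :=
  sInf {x : EReal | ∃ K ∈ 𝒦, BoundedBelow K ∧
    (∀ ϖ ∈ toStop τ ω, f ϖ ≤ liminf (fun t : ℝ≥0 => ((K t ϖ : ℝ) : EReal)) atTop) ∧
    x = ((K (τ ω).toNNReal ω : ℝ) : EReal)}

/-- One-sided elementary trading strategies: stopping times `τ 0 ≤ ⋯ ≤ τ n` and, for each of the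
`n` bets `k = 0, …, n - 1`, two stakes that are nonnegative bounded `τ k`-measurable real variables
defined (at least) on `{τ k < +∞}`. Values at indices outside these ranges play no role. -/
structure OneSidedStrategy where
  n : ℕ
  τ : ℕ → CountingPath → ℝ≥0∞
  upperStake : ℕ → CountingPath → ℝ
  lowerStake : ℕ → CountingPath → ℝ
  isStoppingTime : ∀ k ≤ n, IsStoppingTime (τ k)
  increasing : ∀ k < n, ∀ ω, τ k ω ≤ τ (k + 1) ω
  upperStake_nonneg : ∀ k < n, ∀ ω, τ k ω < ⊤ → 0 ≤ upperStake k ω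
  lowerStake_nonneg : ∀ k < n, ∀ ω, τ k ω < ⊤ → 0 ≤ lowerStake k ω
  upperStake_bounded : ∀ k < n, ∃ B : ℝ, ∀ ω, τ k ω < ⊤ → upperStake k ω ≤ B
  lowerStake_bounded : ∀ k < n, ∃ B : ℝ, ∀ ω, τ k ω < ⊤ → lowerStake k ω ≤ B
  upperStake_measurable : ∀ k < n, MeasurableAt (τ k) {ω | τ k ω < ⊤} (upperStake k)
  lowerStake_measurable : ∀ k < n, MeasurableAt (τ k) {ω | τ k ω < ⊤} (lowerStake k)

/-- The time point `τ(ω) ∧ t`. -/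
noncomputable def stopAt (τ : CountingPath → ℝ≥0∞) (t : ℝ≥0) (ω : CountingPath) : ℝ≥0 :=
  (min (τ ω) (t : ℝ≥0∞)).toNNReal

/-- The capital at time `t` under the one-sided strategy `G` with initial capital `c`, for the rate
bounds `lo` and `hi`. If `τ k ω = +∞`, both factors multiplying the stakes are zero. -/
noncomputable def capital (lo hi : ℝ≥0) (G : OneSidedStrategy) (c : ℝ) (t : ℝ≥0)
    (ω : CountingPath) : ℝ :=
  c + ∑ k ∈ Finset.range G.n,
    (G.upperStake k ω *
        (((ω (stopAt (G.τ (k + 1)) t ω) : ℝ) - (ω (stopAt (G.τ k) t ω) : ℝ))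
          - (hi : ℝ) * ((stopAt (G.τ (k + 1)) t ω : ℝ) - (stopAt (G.τ k) t ω : ℝ)))
      + G.lowerStake k ω *
        ((lo : ℝ) * ((stopAt (G.τ (k + 1)) t ω : ℝ) - (stopAt (G.τ k) t ω : ℝ))
          - ((ω (stopAt (G.τ (k + 1)) t ω) : ℝ) - (ω (stopAt (G.τ k) t ω) : ℝ))))

/-- The set of one-sided elementary capital processes for the rate bounds `lo` and `hi`. -/
def oneSidedCapitalProcesses (lo hi : ℝ≥0) : Set (ℝ≥0 → CountingPath → ℝ) :=
  {K | ∃ (G : OneSidedStrategy) (c : ℝ), K = capital lo hi G c}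

/-- The sublinear Poisson generator on bounded functions on `ℤ≥0`:
`n ↦ max {λ (g (n + 1) - g n) : λ ∈ {lo, hi}}`. -/
noncomputable def generator (lo hi : ℝ≥0) (g : ℕ →ᵇ ℝ) : ℕ →ᵇ ℝ :=
  BoundedContinuousFunction.ofNormedAddCommGroupDiscrete
    (fun n => max ((lo : ℝ) * (g (n + 1) - g n)) ((hi : ℝ) * (g (n + 1) - g n)))
    (((lo : ℝ) + hi) * (‖g‖ + ‖g‖)) (by
      intro n
      have h : |g (n + 1) - g n| ≤ ‖g‖ + ‖g‖ :=
        (abs_sub _ _).trans (add_le_add (g.norm_coe_le_norm _) (g.norm_coe_le_norm _))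
      have hlo : |(lo : ℝ) * (g (n + 1) - g n)| ≤ ((lo : ℝ) + hi) * (‖g‖ + ‖g‖) := by
        rw [abs_mul, abs_of_nonneg lo.coe_nonneg]
        gcongr
        exact le_add_of_nonneg_right hi.coe_nonneg
      have hhi : |(hi : ℝ) * (g (n + 1) - g n)| ≤ ((lo : ℝ) + hi) * (‖g‖ + ‖g‖) := by
        rw [abs_mul, abs_of_nonneg hi.coe_nonneg]
        gcongr
        exact le_add_of_nonneg_left lo.coe_nonneg
      exact abs_max_le_max_abs_abs.trans (max_le hlo hhi))

/-- The operator `(I + (Δ / k) G̅)^k`. -/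
noncomputable def eulerApprox (lo hi Δ : ℝ≥0) (k : ℕ) : (ℕ →ᵇ ℝ) → (ℕ →ᵇ ℝ) :=
  (fun g => g + ((Δ : ℝ) / (k : ℝ)) • generator lo hi g)^[k]

/-- The sublinear Poisson semigroup `S̅_Δ = exp(Δ G̅) = lim_k (I + (Δ / k) G̅)^k`. -/
noncomputable def semigroup (lo hi Δ : ℝ≥0) (g : ℕ →ᵇ ℝ) : ℕ →ᵇ ℝ :=
  limUnder atTop (fun k : ℕ => eulerApprox lo hi Δ k g)

end ImprecisePoisson

/-!
Both assertions follow from one estimate: the upper expectation of `g (N_t)` given time `s` differs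
from the Euler approximation `(I + (Δ / k) G̅)^k g` at the current state by `O(1 / k)`, where
`Δ = t - s` and the constant depends only on `Δ`, the rates and a bound for `‖g‖`
(`exists_upperExpectation_bounds`). Every state is the value of some path at time `1`, so the Euler
approximations form a Cauchy sequence, uniformly on bounded sets, and their limit has to be the
upper expectation. Neither probability nor differential equations are needed. Let `δ = Δ / k`.

*Upper bound.* In each interval of the grid of mesh `δ`, the strategy `hedge` replicates the effect
of the first jump on the Euler approximation, with stakes that are the positive and the negative
part of the difference `w (m + 1) - w m`. The generator is precisely the price of doing so. After
the first jump in the interval, a bet on further jumps covers the case that there are several of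
them. What is lost is of order `δ` in each interval with a jump, and an extra upper stake of
order `δ` throughout, which costs `O(δ)` in total, makes up for it (`le_hedge_gain`,
`le_capital_hedge`).

*Lower bound.* Against a bounded below capital process `K`, an adversary produces a path along which
the potential `V - K` hardly decreases, where `V` interpolates the Euler approximations in
time. While a bet with stakes `a` and `b` is in force in state `m`, either a jump raises the
potential, `w (m + 1) - w m ≥ a - b + η`, and the adversary jumps; or the drift of the potential
without jumps is at least `-hi * η`, and the adversary waits. As the potential is bounded above,
there are only finitely many jumps. There are finitely many bets, so the play is an induction over
them (`exists_waiting_path`, `exists_path_of_jump_or_wait`). From time `t` on, the same play with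
`V = 0` prevents all further gains (`exists_path_capital_le`).
-/

namespace ImprecisePoisson

/-! ### Counting paths -/

namespace CountingPath

/-- The path `ω` stopped at time `u`: it makes no jumps after `u`. -/
noncomputable def freeze (ω : CountingPath) (u : ℝ≥0) : CountingPath where
  toFun x := ω (min x u)
  map_zero' := by simpa using ω.map_zero'
  monotone' x y h := ω.monotone' (min_le_min_right u h)
  rightContinuous' t := by
    have h1 := ω.rightContinuous' (min t u)
    refine ContinuousWithinAt.comp (t := Set.Ici (min t u)) h1
      (Continuous.continuousWithinAt (by fun_prop)) ?_
    intro x hx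
    exact min_le_min_right u hx
  unitJumps' t := by
    rcases le_or_gt t u with h | h
    · filter_upwards [ω.unitJumps' t, self_mem_nhdsWithin] with x hx hxt
      have hxt : x < t := hxt
      rwa [min_eq_left h, min_eq_left (hxt.le.trans h)]
    · filter_upwards [Ioo_mem_nhdsLT h] with x hx
      rw [min_eq_right h.le, min_eq_right hx.1.le]
      exact Nat.le_succ _

/-- The path `ω`, which makes no jumps after time `u`, with one more jump at time `r > u`. -/
noncomputable def addJump (ω : CountingPath) (u r : ℝ≥0) (hur : u < r)
    (hω : ∀ x, u ≤ x → ω x = ω u) : CountingPath where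
  toFun x := ω x + if r ≤ x then 1 else 0
  map_zero' := by
    have : ¬ r ≤ 0 := not_le.2 (lt_of_le_of_lt bot_le hur)
    simp [this, ω.map_zero']
  monotone' x y h := by
    have h1 := ω.monotone' h
    dsimp only
    split_ifs with h2 h3
    · omega
    · exact absurd (h2.trans h) h3
    · omega
    · omega
  rightContinuous' t := by
    refine ContinuousWithinAt.add (ω.rightContinuous' t) ?_
    have : ∀ᶠ x in 𝓝[≥] t, (if r ≤ x then 1 else 0) = if r ≤ t then 1 else 0 := by
      rcases le_or_gt r t with h | h
      · filter_upwards [self_mem_nhdsWithin] with x hx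
        rw [if_pos h, if_pos (h.trans hx)]
      · filter_upwards [mem_nhdsWithin_of_mem_nhds (Iio_mem_nhds h)] with x hx
        rw [if_neg (not_le.2 hx), if_neg (not_le.2 h)]
    exact (continuousWithinAt_const (b := if r ≤ t then 1 else 0)).congr_of_eventuallyEq this rfl
  unitJumps' t := by
    rcases lt_or_ge u t with h | h
    · filter_upwards [Ioo_mem_nhdsLT h] with x hx
      rw [hω t h.le, hω x hx.1.le]
      split_ifs <;> omega
    · filter_upwards [ω.unitJumps' t] with x hx
      rw [if_neg (not_le.2 (h.trans_lt hur))]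
      omega

theorem addJump_of_lt {ω : CountingPath} {u r x : ℝ≥0} (hur : u < r)
    (hω : ∀ x, u ≤ x → ω x = ω u) (hx : x < r) : ω.addJump u r hur hω x = ω x := by
  change ω x + _ = _
  rw [if_neg (not_le.2 hx), add_zero]

theorem addJump_of_le {ω : CountingPath} {u r x : ℝ≥0} (hur : u < r)
    (hω : ∀ x, u ≤ x → ω x = ω u) (hx : r ≤ x) : ω.addJump u r hur hω x = ω u + 1 := by
  change ω x + _ = _
  rw [if_pos hx, hω x (hur.le.trans hx)]

theorem exists_apply_eq {s : ℝ≥0} (hs : 0 < s) (n : ℕ) : ∃ ω : CountingPath, ω s = n := by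
  -- Jumps are added one by one before time `s`.
  suffices ∃ (ω : CountingPath) (u : ℝ≥0), u < s ∧ (∀ x, u ≤ x → ω x = ω u) ∧ ω u = n by
    obtain ⟨ω, u, hu, hω, h⟩ := this
    exact ⟨ω, by rw [hω s hu.le, h]⟩
  induction n with
  | zero =>
    exact ⟨⟨fun _ => 0, rfl, monotone_const, fun _ => continuousWithinAt_const,
      fun _ => by simp⟩, 0, hs, fun _ _ => rfl, rfl⟩
  | succ n ih =>
    obtain ⟨ω, u, hu, hω, h⟩ := ih
    obtain ⟨r, hur, hrs⟩ := exists_between hu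
    refine ⟨ω.addJump u r hur hω, r, hrs, fun x hx => ?_, ?_⟩
    · rw [addJump_of_le hur hω hx, addJump_of_le hur hω le_rfl]
    · rw [addJump_of_le hur hω le_rfl, h]

end CountingPath

theorem AgreeUpTo.symm {a : ℝ≥0∞} {ω₁ ω₂ : CountingPath} (h : AgreeUpTo a ω₁ ω₂) :
    AgreeUpTo a ω₂ ω₁ := fun r hr => (h r hr).symm

theorem AgreeUpTo.trans {a : ℝ≥0∞} {ω₁ ω₂ ω₃ : CountingPath} (h : AgreeUpTo a ω₁ ω₂)
    (h' : AgreeUpTo a ω₂ ω₃) : AgreeUpTo a ω₁ ω₃ := fun r hr => (h r hr).trans (h' r hr)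

theorem AgreeUpTo.mono {a b : ℝ≥0∞} {ω₁ ω₂ : CountingPath} (h : AgreeUpTo b ω₁ ω₂)
    (hab : a ≤ b) : AgreeUpTo a ω₁ ω₂ := fun r hr => h r (hr.trans hab)

/-! ### Stopping times and capital processes -/

theorem stopAt_of_le {τ : CountingPath → ℝ≥0∞} {t : ℝ≥0} {ω : CountingPath} (h : (t : ℝ≥0∞) ≤ τ ω) :
    stopAt τ t ω = t := by
  rw [stopAt, min_eq_right h, ENNReal.toNNReal_coe]

theorem stopAt_of_ge {τ : CountingPath → ℝ≥0∞} {t : ℝ≥0} {ω : CountingPath} (h : τ ω ≤ t) :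
    stopAt τ t ω = (τ ω).toNNReal := by
  rw [stopAt, min_eq_left h]

theorem stopAt_coe (τ : CountingPath → ℝ≥0) (t : ℝ≥0) (ω : CountingPath) :
    stopAt (fun ω => (τ ω : ℝ≥0∞)) t ω = min (τ ω) t := by
  rw [stopAt, ← ENNReal.coe_min, ENNReal.toNNReal_coe]

theorem stopAt_le (τ : CountingPath → ℝ≥0∞) (t : ℝ≥0) (ω : CountingPath) : stopAt τ t ω ≤ t := by
  rw [stopAt, ← ENNReal.coe_le_coe, ENNReal.coe_toNNReal (ne_top_of_le_ne_top ENNReal.coe_ne_top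
    (min_le_right _ _))]
  exact min_le_right _ _

namespace IsStoppingTime

variable {τ : CountingPath → ℝ≥0∞}

theorem eq_of_agreeUpTo (hτ : IsStoppingTime τ) {a : ℝ≥0∞} {ω₁ ω₂ : CountingPath}
    (h : AgreeUpTo a ω₁ ω₂) (ha : τ ω₁ ≤ a) : τ ω₁ = τ ω₂ := hτ _ _ (h.mono ha)

theorem stopAt_eq (hτ : IsStoppingTime τ) {t : ℝ≥0} {ω₁ ω₂ : CountingPath}
    (h : AgreeUpTo t ω₁ ω₂) : stopAt τ t ω₁ = stopAt τ t ω₂ := by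
  rcases le_total (τ ω₁) t with h1 | h1
  · rw [stopAt, stopAt, hτ.eq_of_agreeUpTo h h1]
  rcases le_total (τ ω₂) t with h2 | h2
  · rw [stopAt, stopAt, hτ.eq_of_agreeUpTo h.symm h2]
  rw [stopAt_of_le h1, stopAt_of_le h2]

/-- A stopping time that has not yet occurred strictly before `r` cannot be made to do so by
changing the path from time `r` on. -/
theorem le_of_agree_before (hτ : IsStoppingTime τ) {r : ℝ≥0} {ω₁ ω₂ : CountingPath}
    (h : ∀ x < r, ω₁ x = ω₂ x) (hr : (r : ℝ≥0∞) ≤ τ ω₁) : (r : ℝ≥0∞) ≤ τ ω₂ := by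
  by_contra! hlt
  have : τ ω₂ = τ ω₁ := hτ _ _ fun x hx => (h x (by exact_mod_cast hx.trans_lt hlt)).symm
  exact absurd (this ▸ hlt) (not_lt.2 hr)

end IsStoppingTime

namespace OneSidedStrategy

variable (G : OneSidedStrategy)

theorem τ_le_τ {j k : ℕ} (hjk : j ≤ k) (hk : k ≤ G.n) (ω : CountingPath) : G.τ j ω ≤ G.τ k ω := by
  induction k, hjk using Nat.le_induction with
  | base => exact le_rfl
  | succ k _ ih => exact (ih (by omega)).trans (G.increasing k (by omega) ω)

/-- The strategy `G` with two more bets, both with stakes zero: one from time `0` to the first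
stopping time of `G`, and one from the last stopping time of `G` on. -/
noncomputable def extend : OneSidedStrategy where
  n := G.n + 2
  τ k ω := if k = 0 then 0 else if k ≤ G.n + 1 then G.τ (k - 1) ω else ⊤
  upperStake k ω := if 1 ≤ k ∧ k ≤ G.n then G.upperStake (k - 1) ω else 0
  lowerStake k ω := if 1 ≤ k ∧ k ≤ G.n then G.lowerStake (k - 1) ω else 0
  isStoppingTime k hk := by
    intro ω₁ ω₂ h
    by_cases h0 : k = 0
    · simp [h0]
    by_cases h1 : k ≤ G.n + 1
    · simp only [h0, h1, if_true, if_false] at h ⊢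
      exact G.isStoppingTime (k - 1) (by omega) _ _ h
    · simp [h0, h1]
  increasing k hk ω := by
    by_cases h0 : k = 0
    · simp [h0]
    by_cases h1 : k + 1 ≤ G.n + 1
    · obtain ⟨j, rfl⟩ := Nat.exists_eq_succ_of_ne_zero h0
      simpa [h1, show j + 1 ≤ G.n + 1 by omega] using G.increasing j (by omega) ω
    · simp [h1]
  upperStake_nonneg k hk ω h := by
    split_ifs with hc
    · refine G.upperStake_nonneg (k - 1) (by omega) ω ?_
      simpa [show k ≠ 0 by omega, show k ≤ G.n + 1 by omega] using h
    · exact le_rfl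
  lowerStake_nonneg k hk ω h := by
    split_ifs with hc
    · refine G.lowerStake_nonneg (k - 1) (by omega) ω ?_
      simpa [show k ≠ 0 by omega, show k ≤ G.n + 1 by omega] using h
    · exact le_rfl
  upperStake_bounded k hk := by
    by_cases hc : 1 ≤ k ∧ k ≤ G.n
    · simpa [hc, show k ≠ 0 by omega, show k ≤ G.n + 1 by omega] using
        G.upperStake_bounded (k - 1) (by omega)
    · exact ⟨0, fun ω _ => by simp [hc]⟩
  lowerStake_bounded k hk := by
    by_cases hc : 1 ≤ k ∧ k ≤ G.n
    · simpa [hc, show k ≠ 0 by omega, show k ≤ G.n + 1 by omega] using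
        G.lowerStake_bounded (k - 1) (by omega)
    · exact ⟨0, fun ω _ => by simp [hc]⟩
  upperStake_measurable k hk := by
    by_cases hc : 1 ≤ k ∧ k ≤ G.n
    · simpa [hc, show k ≠ 0 by omega, show k ≤ G.n + 1 by omega] using
        G.upperStake_measurable (k - 1) (by omega)
    · intro _ _ _ _ _
      simp [hc]
  lowerStake_measurable k hk := by
    by_cases hc : 1 ≤ k ∧ k ≤ G.n
    · simpa [hc, show k ≠ 0 by omega, show k ≤ G.n + 1 by omega] using
        G.lowerStake_measurable (k - 1) (by omega)
    · intro _ _ _ _ _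
      simp [hc]

theorem extend_τ_zero (ω : CountingPath) : G.extend.τ 0 ω = 0 := rfl

theorem extend_τ_last (ω : CountingPath) : G.extend.τ G.extend.n ω = ⊤ := by
  simp [extend]

theorem capital_extend (lo hi : ℝ≥0) (c : ℝ) : capital lo hi G.extend c = capital lo hi G c := by
  funext t ω
  rw [capital, capital, show G.extend.n = G.n + 2 from rfl, Finset.sum_range_succ,
    Finset.sum_range_succ']
  congr 1
  simp only [extend]
  simp only [zero_mul, add_zero, if_false, show ¬ (1 ≤ 0 ∧ 0 ≤ G.n) by omega,
    show ¬ (1 ≤ G.n + 1 ∧ G.n + 1 ≤ G.n) by omega]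
  refine Finset.sum_congr rfl fun k hk => ?_
  have hk := Finset.mem_range.1 hk
  simp only [show 1 ≤ k + 1 ∧ k + 1 ≤ G.n by omega, show k + 1 ≤ G.n + 1 by omega,
    show k + 1 + 1 ≤ G.n + 1 by omega, Nat.succ_ne_zero, if_true, if_false,
    Nat.add_sub_cancel, and_self]

end OneSidedStrategy

/-- While a bet is in force, the capital evolves according to the stakes of that bet only. -/
theorem capital_eq_of_mem_bet (lo hi : ℝ≥0) (G : OneSidedStrategy) (c : ℝ) {k : ℕ} (hk : k < G.n)
    {u r : ℝ≥0} {ω : CountingPath} (hu : G.τ k ω ≤ u) (hur : u ≤ r)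
    (hr : (r : ℝ≥0∞) ≤ G.τ (k + 1) ω) :
    capital lo hi G c r ω = capital lo hi G c u ω
      + (G.upperStake k ω * (((ω r : ℝ) - ω u) - hi * ((r : ℝ) - u))
      + G.lowerStake k ω * (lo * ((r : ℝ) - u) - ((ω r : ℝ) - ω u))) := by
  have hur' : (u : ℝ≥0∞) ≤ r := by exact_mod_cast hur
  rw [← sub_eq_iff_eq_add', capital, capital, add_sub_add_left_eq_sub, ← Finset.sum_sub_distrib,
    Finset.sum_eq_single_of_mem k (Finset.mem_range.2 hk)]
  · rw [stopAt_of_ge hu, stopAt_of_ge (hu.trans hur'), stopAt_of_le hr,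
      stopAt_of_le (hur'.trans hr)]
    ring
  · intro j hj hjk
    have hj := Finset.mem_range.1 hj
    rcases lt_or_gt_of_ne hjk with h | h
    · have h1 : G.τ (j + 1) ω ≤ u := (G.τ_le_τ h hk.le ω).trans hu
      have h2 : G.τ j ω ≤ u := (G.increasing j hj ω).trans h1
      rw [stopAt_of_ge h1, stopAt_of_ge (h1.trans hur'), stopAt_of_ge h2,
        stopAt_of_ge (h2.trans hur')]
      ring
    · have h1 : (r : ℝ≥0∞) ≤ G.τ j ω := hr.trans (G.τ_le_τ h hj.le ω)
      have h2 : (r : ℝ≥0∞) ≤ G.τ (j + 1) ω := h1.trans (G.increasing j hj ω)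
      rw [stopAt_of_le h1, stopAt_of_le (hur'.trans h1), stopAt_of_le h2,
        stopAt_of_le (hur'.trans h2)]
      ring

/-- Capital processes are adapted. -/
theorem capital_eq_of_agreeUpTo (lo hi : ℝ≥0) (G : OneSidedStrategy) (c : ℝ) {u : ℝ≥0}
    {ω₁ ω₂ : CountingPath} (h : AgreeUpTo u ω₁ ω₂) :
    capital lo hi G c u ω₁ = capital lo hi G c u ω₂ := by
  rw [capital, capital]
  congr 1
  refine Finset.sum_congr rfl fun k hk => ?_
  have hk := Finset.mem_range.1 hk
  have e1 := (G.isStoppingTime k hk.le).stopAt_eq h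
  have e2 := (G.isStoppingTime (k + 1) hk).stopAt_eq h
  have hω : ∀ τ, ω₁ (stopAt τ u ω₂) = ω₂ (stopAt τ u ω₂) := fun τ =>
    h _ (by exact_mod_cast stopAt_le τ u ω₂)
  rw [e1, e2, hω, hω]
  rcases le_or_gt (G.τ k ω₁) u with h1 | h1
  · have h2 := (G.isStoppingTime k hk.le).eq_of_agreeUpTo h h1
    have f1 : G.τ k ω₁ < ⊤ := h1.trans_lt ENNReal.coe_lt_top
    have f2 : G.τ k ω₂ < ⊤ := h2 ▸ f1
    rw [G.upperStake_measurable k hk ω₁ f1 ω₂ f2 (h.mono h1),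
      G.lowerStake_measurable k hk ω₁ f1 ω₂ f2 (h.mono h1)]
  · have e3 := e1.symm.trans (stopAt_of_le h1.le)
    have e4 := e2.symm.trans (stopAt_of_le (h1.le.trans (G.increasing k hk ω₁)))
    rw [e3, e4]
    ring

/-! ### The adversary against a bounded below capital process -/

/-- The adversary's play during one bet with stakes `a` and `b`. The potential is `V - K`, where
`V r m` is a target value for `m` jumps up to time `r`. The adversary jumps almost immediately as
long as this raises the potential by a fixed amount `θ`; since `V` is bounded above and `K` is
bounded below, this stops after finitely many jumps, and from then on waiting costs at most `ρ` per
unit of time. -/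
theorem exists_waiting_path {lo hi : ℝ≥0} {G : OneSidedStrategy} {c : ℝ}
    {B : ℝ} (hB : ∀ t ω, B ≤ capital lo hi G c t ω) {V : ℝ≥0 → ℕ → ℝ} {L M ρ θ : ℝ}
    (hL : 0 ≤ L) (hVL : ∀ r r' m, r ≤ r' → V r m - L * ((r' : ℝ) - r) ≤ V r' m)
    {u₀ : ℝ≥0} {e : ℝ≥0∞} (hVM : ∀ (r : ℝ≥0) m, r ≤ e → V r m ≤ M) (hρ : 0 ≤ ρ) (hθ : 0 < θ)
    {k : ℕ} (hk : k < G.n) {a b : ℝ}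
    (hV : ∀ m, (∀ r, u₀ ≤ r → (r : ℝ≥0∞) ≤ e → V r m + (a - b) + θ ≤ V r (m + 1)) ∨
      ∀ r r' : ℝ≥0, u₀ ≤ r → r ≤ r' → (r' : ℝ≥0∞) ≤ e →
        V r m - ρ * ((r' : ℝ) - r) ≤ V r' m + (hi * a - lo * b) * ((r' : ℝ) - r))
    {u : ℝ≥0} {ω : CountingPath} (hω : ∀ x, u ≤ x → ω x = ω u) (hu₀ : u₀ ≤ u)
    (hue : (u : ℝ≥0∞) ≤ e) (hku : G.τ k ω ≤ u) (huk : (u : ℝ≥0∞) ≤ G.τ (k + 1) ω)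
    (ha : G.upperStake k ω = a) (hb : G.lowerStake k ω = b) :
    ∃ (ϖ : CountingPath) (v : ℝ≥0), u ≤ v ∧ (v : ℝ≥0∞) ≤ e ∧ (v : ℝ≥0∞) ≤ G.τ (k + 1) ϖ ∧
      AgreeUpTo u ϖ ω ∧ (∀ x, v ≤ x → ϖ x = ϖ v) ∧
      ∀ r : ℝ≥0, v ≤ r → (r : ℝ≥0∞) ≤ e → (r : ℝ≥0∞) ≤ G.τ (k + 1) ϖ →
        V u (ω u) - capital lo hi G c u ω - ρ * ((r : ℝ) - u)
          ≤ V r (ϖ r) - capital lo hi G c r ϖ := by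
  have hb0 : 0 ≤ b :=
    hb ▸ G.lowerStake_nonneg k hk ω (hku.trans_lt ENNReal.coe_lt_top)
  have ha0 : 0 ≤ a :=
    ha ▸ G.upperStake_nonneg k hk ω (hku.trans_lt ENNReal.coe_lt_top)
  -- The induction is on the number of jumps that the bounds on the potential still allow.
  obtain ⟨p, hp⟩ : ∃ p : ℕ, M - B - (V u (ω u) - capital lo hi G c u ω) < p * (θ / 2) := by
    obtain ⟨p, hp⟩ := exists_nat_gt ((M - B - (V u (ω u) - capital lo hi G c u ω)) / (θ / 2))
    exact ⟨p, by rwa [div_lt_iff₀ (by positivity)] at hp⟩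
  induction p generalizing u ω with
  | zero =>
    have h1 := hVM u (ω u) hue
    have h2 := hB u ω
    rw [Nat.cast_zero, zero_mul] at hp
    linarith
  | succ p ih =>
    by_cases hend : (u : ℝ≥0∞) = e ∨ (u : ℝ≥0∞) = G.τ (k + 1) ω
    · -- The bet or the horizon is over, so nothing remains to be done.
      refine ⟨ω, u, le_rfl, hue, huk, fun _ _ => rfl, hω, fun r hur hre hrk => ?_⟩
      have : r = u := by
        refine le_antisymm ?_ hur
        rcases hend with h | h
        · rw [← h] at hre; exact_mod_cast hre
        · rw [← h] at hrk; exact_mod_cast hrk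
      subst this
      simp
    push Not at hend
    have hue' := lt_of_le_of_ne hue hend.1
    have huk' := lt_of_le_of_ne huk hend.2
    rcases hV (ω u) with hjump | hwait
    · -- The jump takes place so early that the drift before it costs at most half of its gain.
      obtain ⟨r, hur, hre, hrk, hrs⟩ : ∃ r : ℝ≥0, u < r ∧ (r : ℝ≥0∞) ≤ e ∧
          (r : ℝ≥0∞) ≤ G.τ (k + 1) ω ∧ (L + lo * b) * ((r : ℝ) - u) ≤ θ / 2 := by
        obtain ⟨z, hz1, hz2⟩ := ENNReal.lt_iff_exists_nnreal_btwn.1 (lt_min hue' huk')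
        have hz1 : u < z := by exact_mod_cast hz1
        have hd : 0 < L + lo * b + 1 := by positivity
        obtain ⟨d, hdd⟩ : ∃ d : ℝ≥0, (d : ℝ) = θ / 2 / (L + lo * b + 1) :=
          ⟨_, Real.coe_toNNReal _ (by positivity)⟩
        have hd0 : 0 < d := NNReal.coe_pos.1 (by rw [hdd]; positivity)
        have hle : ((min z (u + d) : ℝ≥0) : ℝ≥0∞) ≤ min e (G.τ (k + 1) ω) :=
          (ENNReal.coe_le_coe.2 (min_le_left _ _)).trans hz2.le
        refine ⟨min z (u + d), lt_min hz1 (lt_add_of_pos_right u hd0),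
          hle.trans (min_le_left _ _), hle.trans (min_le_right _ _), ?_⟩
        have h1 : ((min z (u + d) : ℝ≥0) : ℝ) ≤ u + d := by exact_mod_cast min_le_right z (u + d)
        calc (L + lo * b) * (((min z (u + d) : ℝ≥0) : ℝ) - u)
            ≤ (L + lo * b) * d := by gcongr; linarith
          _ ≤ (L + lo * b + 1) * d :=
              mul_le_mul_of_nonneg_right (by linarith) d.coe_nonneg
          _ = θ / 2 := by rw [hdd]; field_simp
      set ϖ := ω.addJump u r hur hω with hϖ
      have hbefore : ∀ x < r, ω x = ϖ x := fun x hx =>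
        (CountingPath.addJump_of_lt hur hω hx).symm
      have hafter : ∀ x, r ≤ x → ϖ x = ω u + 1 := fun x hx =>
        CountingPath.addJump_of_le hur hω hx
      have hagree : AgreeUpTo u ω ϖ := fun x hx =>
        hbefore x (lt_of_le_of_lt (by exact_mod_cast hx) hur)
      have hτ : G.τ k ω = G.τ k ϖ :=
        (G.isStoppingTime k hk.le).eq_of_agreeUpTo hagree hku
      have hfin : G.τ k ω < ⊤ := hku.trans_lt ENNReal.coe_lt_top
      have hfin' : G.τ k ϖ < ⊤ := hτ ▸ hfin
      have hku' : G.τ k ϖ ≤ u := hτ ▸ hku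
      have hrk' : (r : ℝ≥0∞) ≤ G.τ (k + 1) ϖ :=
        (G.isStoppingTime (k + 1) hk).le_of_agree_before hbefore hrk
      have ha' : G.upperStake k ϖ = a :=
        (G.upperStake_measurable k hk ω hfin ϖ hfin' (hagree.mono hku)).symm.trans ha
      have hb' : G.lowerStake k ϖ = b :=
        (G.lowerStake_measurable k hk ω hfin ϖ hfin' (hagree.mono hku)).symm.trans hb
      have hK := capital_eq_of_mem_bet lo hi G c hk hku' hur.le hrk'
      rw [← capital_eq_of_agreeUpTo lo hi G c hagree, ha', hb', hafter r le_rfl,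
        ← hbefore u hur] at hK
      push_cast at hK
      have hgain : V u (ω u) - capital lo hi G c u ω + θ / 2 ≤
          V r (ϖ r) - capital lo hi G c r ϖ := by
        rw [hK, hafter r le_rfl]
        have h1 := hjump r (hu₀.trans hur.le) hre
        have h2 := hVL u r (ω u) hur.le
        have h3 : 0 ≤ (hi : ℝ) * a * ((r : ℝ) - u) := by
          have : (u : ℝ) ≤ r := by exact_mod_cast hur.le
          have := sub_nonneg.2 this
          positivity
        linarith
      obtain ⟨ϖ', v, hrv, hve, hvk, hag, hc, hr⟩ := ih (u := r) (ω := ϖ)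
        (fun x hx => by rw [hafter x hx, hafter r le_rfl]) (hu₀.trans hur.le) hre
        (hku'.trans (by exact_mod_cast hur.le)) hrk' ha' hb' (by push_cast at hp; linarith)
      refine ⟨ϖ', v, hur.le.trans hrv, hve, hvk,
        (hag.mono (by exact_mod_cast hur.le)).trans hagree.symm, hc, fun x hx hxe hxk => ?_⟩
      have h1 := hr x hx hxe hxk
      have h2 : ρ * ((x : ℝ) - r) ≤ ρ * ((x : ℝ) - u) := by
        have : (u : ℝ) ≤ r := by exact_mod_cast hur.le
        gcongr
      linarith
    · refine ⟨ω, u, le_rfl, hue, huk, fun _ _ => rfl, hω, fun r hur hre hrk => ?_⟩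
      have h1 := hwait u r hu₀ hur hre
      rw [capital_eq_of_mem_bet lo hi G c hk hku hur hrk, hω r hur, ha, hb]
      linarith

/-- The adversary's play from time `u` up to the horizon `e`, which may be infinite: a path can
be continued such that the potential `V - K` decreases at most at rate `ρ`, provided that, for
all stakes `a` and `b`, jumping raises the potential by a fixed amount or waiting costs at most `ρ`
per unit of time. -/
theorem exists_path_of_jump_or_wait {lo hi : ℝ≥0} {G : OneSidedStrategy} {c : ℝ}
    {B : ℝ} (hB : ∀ t ω, B ≤ capital lo hi G c t ω) {V : ℝ≥0 → ℕ → ℝ} {L M ρ : ℝ}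
    (hL : 0 ≤ L) (hVL : ∀ r r' m, r ≤ r' → V r m - L * ((r' : ℝ) - r) ≤ V r' m)
    {u : ℝ≥0} {e : ℝ≥0∞} (hVM : ∀ (r : ℝ≥0) m, r ≤ e → V r m ≤ M) (hρ : 0 ≤ ρ)
    (hV : ∀ a b : ℝ, 0 ≤ a → 0 ≤ b → ∃ θ : ℝ, 0 < θ ∧ ∀ m,
      (∀ r, u ≤ r → (r : ℝ≥0∞) ≤ e → V r m + (a - b) + θ ≤ V r (m + 1)) ∨
      ∀ r r' : ℝ≥0, u ≤ r → r ≤ r' → (r' : ℝ≥0∞) ≤ e →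
        V r m - ρ * ((r' : ℝ) - r) ≤ V r' m + (hi * a - lo * b) * ((r' : ℝ) - r))
    {ω : CountingPath} (hω : ∀ x, u ≤ x → ω x = ω u) (hue : (u : ℝ≥0∞) ≤ e) :
    ∃ (ϖ : CountingPath) (v : ℝ≥0), u ≤ v ∧ (v : ℝ≥0∞) ≤ e ∧ AgreeUpTo u ϖ ω ∧
      (∀ x, v ≤ x → ϖ x = ϖ v) ∧ ∀ r : ℝ≥0, v ≤ r → (r : ℝ≥0∞) ≤ e →
        V u (ω u) - capital lo hi G c u ω - ρ * ((r : ℝ) - u)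
          ≤ V r (ϖ r) - capital lo hi G c r ϖ := by
  -- After this reduction, there is a bet in force at every time.
  wlog hG : (∀ ω, G.τ 0 ω = 0) ∧ ∀ ω, G.τ G.n ω = ⊤ generalizing G
  · have := this (G := G.extend) (by simpa only [G.capital_extend] using hB)
      ⟨G.extend_τ_zero, G.extend_τ_last⟩
    simpa only [G.capital_extend] using this
  -- The induction is on the number of bets from the one in force at time `u'` on.
  suffices H : ∀ (p k : ℕ), k + p = G.n → ∀ (u' : ℝ≥0) (ω : CountingPath), u ≤ u' →
      (u' : ℝ≥0∞) ≤ e → G.τ k ω ≤ u' → (∀ x, u' ≤ x → ω x = ω u') →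
      ∃ (ϖ : CountingPath) (v : ℝ≥0), u' ≤ v ∧ (v : ℝ≥0∞) ≤ e ∧ AgreeUpTo u' ϖ ω ∧
        (∀ x, v ≤ x → ϖ x = ϖ v) ∧ ∀ r : ℝ≥0, v ≤ r → (r : ℝ≥0∞) ≤ e →
          V u' (ω u') - capital lo hi G c u' ω - ρ * ((r : ℝ) - u')
            ≤ V r (ϖ r) - capital lo hi G c r ϖ from
    H G.n 0 (zero_add _) u ω le_rfl hue (by rw [hG.1]; exact bot_le) hω
  intro p
  induction p with
  | zero =>
    intro k hk u' ω _ _ hku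
    rw [add_zero] at hk
    rw [hk, hG.2] at hku
    exact absurd hku (not_le.2 ENNReal.coe_lt_top)
  | succ p ih =>
    intro k hk u' ω huu' hu'e hku hω
    rcases le_or_gt (G.τ (k + 1) ω) u' with h | h
    · exact ih (k + 1) (by omega) u' ω huu' hu'e h hω
    have hkn : k < G.n := by omega
    have hfin : G.τ k ω < ⊤ := hku.trans_lt ENNReal.coe_lt_top
    obtain ⟨θ, hθ, hθV⟩ := hV _ _ (G.upperStake_nonneg k hkn ω hfin)
      (G.lowerStake_nonneg k hkn ω hfin)
    obtain ⟨ϖ, v, huv, hve, hvk, hag, hc, hr⟩ := exists_waiting_path hB hL hVL hVM hρ hθ hkn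
      hθV hω huu' hu'e hku h.le rfl rfl
    rcases le_or_gt e (G.τ (k + 1) ϖ) with h1 | h1
    · exact ⟨ϖ, v, huv, hve, hag, hc, fun r hvr hre => hr r hvr hre (hre.trans h1)⟩
    obtain ⟨w, hw⟩ : ∃ w : ℝ≥0, (w : ℝ≥0∞) = G.τ (k + 1) ϖ :=
      ⟨_, ENNReal.coe_toNNReal (ne_top_of_lt h1)⟩
    rw [← hw] at h1 hvk
    have hvw : v ≤ w := by exact_mod_cast hvk
    obtain ⟨ϖ', v', hwv, hv'e, hag', hc', hr'⟩ := ih (k + 1) (by omega) w ϖ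
      (huu'.trans (huv.trans hvw)) h1.le hw.ge
      (fun x hx => by rw [hc x (hvw.trans hx), hc w hvw])
    refine ⟨ϖ', v', huv.trans (hvw.trans hwv), hv'e,
      (hag'.mono (by exact_mod_cast huv.trans hvw)).trans hag, hc', fun r hvr hre => ?_⟩
    have h2 := hr w hvw h1.le hw.le
    have h3 := hr' r hvr hre
    linarith

/-! ### The generator and its Euler approximations -/

/-- The operator `I + δ G̅`. -/
noncomputable def eulerStep (lo hi : ℝ≥0) (δ : ℝ) (g : ℕ →ᵇ ℝ) : ℕ →ᵇ ℝ :=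
  g + δ • generator lo hi g

theorem generator_apply (lo hi : ℝ≥0) (g : ℕ →ᵇ ℝ) (n : ℕ) :
    generator lo hi g n = max ((lo : ℝ) * (g (n + 1) - g n)) ((hi : ℝ) * (g (n + 1) - g n)) := rfl

theorem eulerStep_apply (lo hi : ℝ≥0) (δ : ℝ) (g : ℕ →ᵇ ℝ) (n : ℕ) :
    eulerStep lo hi δ g n = g n + δ * generator lo hi g n := rfl

theorem abs_sub_apply_le (g : ℕ →ᵇ ℝ) (m n : ℕ) : |g m - g n| ≤ 2 * ‖g‖ := by
  rw [← Real.dist_eq]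
  exact g.dist_le_two_norm m n

theorem norm_generator_le {lo hi : ℝ≥0} (hle : lo ≤ hi) (g : ℕ →ᵇ ℝ) :
    ‖generator lo hi g‖ ≤ 2 * hi * ‖g‖ := by
  refine (BoundedContinuousFunction.norm_le (by positivity)).2 fun n => ?_
  have h := abs_sub_apply_le g (n + 1) n
  have hle' : (lo : ℝ) ≤ hi := hle
  rw [generator_apply, Real.norm_eq_abs]
  refine abs_max_le_max_abs_abs.trans (max_le ?_ ?_)
  · rw [abs_mul, abs_of_nonneg lo.coe_nonneg]
    calc (lo : ℝ) * |g (n + 1) - g n| ≤ hi * (2 * ‖g‖) := by gcongr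
      _ = _ := by ring
  · rw [abs_mul, abs_of_nonneg hi.coe_nonneg]
    calc (hi : ℝ) * |g (n + 1) - g n| ≤ hi * (2 * ‖g‖) := by gcongr
      _ = _ := by ring

theorem norm_eulerStep_le {lo hi : ℝ≥0} (hle : lo ≤ hi) {δ : ℝ} (hδ : 0 ≤ δ) (g : ℕ →ᵇ ℝ) :
    ‖eulerStep lo hi δ g‖ ≤ Real.exp (2 * hi * δ) * ‖g‖ := by
  calc ‖eulerStep lo hi δ g‖ ≤ ‖g‖ + ‖δ • generator lo hi g‖ := norm_add_le _ _
    _ ≤ ‖g‖ + δ * (2 * hi * ‖g‖) := by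
        rw [norm_smul, Real.norm_of_nonneg hδ]
        gcongr
        exact norm_generator_le hle g
    _ = (2 * hi * δ + 1) * ‖g‖ := by ring
    _ ≤ _ := by gcongr; exact Real.add_one_le_exp _

theorem norm_iterate_eulerStep_le {lo hi : ℝ≥0} (hle : lo ≤ hi) {δ : ℝ} (hδ : 0 ≤ δ)
    (g : ℕ →ᵇ ℝ) (p : ℕ) :
    ‖(eulerStep lo hi δ)^[p] g‖ ≤ Real.exp (2 * hi * (p * δ)) * ‖g‖ := by
  induction p with
  | zero => simp
  | succ p ih =>
    rw [Function.iterate_succ_apply']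
    refine (norm_eulerStep_le hle hδ _).trans ?_
    calc Real.exp (2 * hi * δ) * ‖(eulerStep lo hi δ)^[p] g‖
        ≤ Real.exp (2 * hi * δ) * (Real.exp (2 * hi * (p * δ)) * ‖g‖) := by gcongr
      _ = _ := by rw [← mul_assoc, ← Real.exp_add]; push_cast; ring_nf

/-! ### The lower bound -/

/-- The adversary's play during one Euler step. The potential interpolates linearly between
`(I + δ G̅) w` and `w`. -/
theorem exists_path_eulerStep {lo hi : ℝ≥0} (hle : lo ≤ hi) {G : OneSidedStrategy} {c : ℝ}
    {B : ℝ} (hB : ∀ t ω, B ≤ capital lo hi G c t ω) (w : ℕ →ᵇ ℝ) {δ : ℝ≥0} {η : ℝ} (hη : 0 < η)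
    (hw : 4 * δ * ‖generator lo hi w‖ ≤ η) {u : ℝ≥0} {ω : CountingPath}
    (hω : ∀ x, u ≤ x → ω x = ω u) :
    ∃ ϖ : CountingPath, AgreeUpTo u ϖ ω ∧ (∀ x, u + δ ≤ x → ϖ x = ϖ (u + δ)) ∧
      eulerStep lo hi δ w (ω u) - capital lo hi G c u ω - hi * η * δ
        ≤ w (ϖ (u + δ)) - capital lo hi G c (u + δ) ϖ := by
  set g := generator lo hi w with hg
  have hgn : ∀ m, |g m| ≤ ‖g‖ := g.norm_coe_le_norm
  have hle' : (lo : ℝ) ≤ hi := hle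
  set V : ℝ≥0 → ℕ → ℝ := fun r m => w m + ((u : ℝ) + δ - r) * g m with hVdef
  have hVL : ∀ r r' m, r ≤ r' → V r m - ‖g‖ * ((r' : ℝ) - r) ≤ V r' m := by
    intro r r' m hr
    have hr : (0 : ℝ) ≤ (r' : ℝ) - r := sub_nonneg.2 (by exact_mod_cast hr)
    have := mul_le_mul_of_nonneg_right (abs_le.1 (hgn m)).2 hr
    simp only [hVdef]
    linarith
  have hVM : ∀ (r : ℝ≥0) m, (r : ℝ≥0∞) ≤ ((u + δ : ℝ≥0) : ℝ≥0∞) →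
      V r m ≤ ‖w‖ + (u + δ) * ‖g‖ := by
    intro r m hr
    have hr : (r : ℝ) ≤ u + δ := by
      have : r ≤ u + δ := by exact_mod_cast hr
      exact_mod_cast this
    have h1 := (le_abs_self _).trans (w.norm_coe_le_norm m)
    have h2 : ((u : ℝ) + δ - r) * g m ≤ (u + δ) * ‖g‖ := by
      have h3 := (abs_le.1 (hgn m)).2
      have h4 := r.coe_nonneg
      calc ((u : ℝ) + δ - r) * g m ≤ ((u : ℝ) + δ - r) * ‖g‖ := by
            exact mul_le_mul_of_nonneg_left h3 (by linarith)
        _ ≤ _ := by gcongr; linarith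
    exact add_le_add h1 h2
  have hV : ∀ a b : ℝ, 0 ≤ a → 0 ≤ b → ∃ θ : ℝ, 0 < θ ∧ ∀ m,
      (∀ r, u ≤ r → (r : ℝ≥0∞) ≤ ((u + δ : ℝ≥0) : ℝ≥0∞) → V r m + (a - b) + θ ≤ V r (m + 1)) ∨
      ∀ r r' : ℝ≥0, u ≤ r → r ≤ r' → (r' : ℝ≥0∞) ≤ ((u + δ : ℝ≥0) : ℝ≥0∞) →
        V r m - hi * η * ((r' : ℝ) - r) ≤ V r' m + (hi * a - lo * b) * ((r' : ℝ) - r) := by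
    intro a b ha hb
    refine ⟨η / 2, by positivity, fun m => ?_⟩
    rcases le_or_gt (a - b + η) (w (m + 1) - w m) with h | h
    · left
      intro r hur hr
      have hur : (u : ℝ) ≤ r := by exact_mod_cast hur
      have hr : (r : ℝ) ≤ u + δ := by
        have : r ≤ u + δ := by exact_mod_cast hr
        exact_mod_cast this
      -- The interpolation changes the gain from a jump by at most `η / 2`.
      have h1 : ((u : ℝ) + δ - r) * (g m - g (m + 1)) ≤ δ * (2 * ‖g‖) := by
        have h2 : g m - g (m + 1) ≤ 2 * ‖g‖ := (le_abs_self _).trans (abs_sub_apply_le g _ _)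
        calc ((u : ℝ) + δ - r) * (g m - g (m + 1)) ≤ ((u : ℝ) + δ - r) * (2 * ‖g‖) :=
              mul_le_mul_of_nonneg_left h2 (by linarith)
          _ ≤ _ := by gcongr; linarith
      simp only [hVdef]
      linarith
    · right
      intro r r' _ hr _
      have hr : (0 : ℝ) ≤ (r' : ℝ) - r := sub_nonneg.2 (by exact_mod_cast hr)
      -- The stakes `a` and `b` cost at least as much as the replication of `w` does, up to `η`.
      have h1 : g m ≤ hi * a - lo * b + hi * η := by
        rw [hg, generator_apply]
        refine max_le ?_ ?_
        · have h2 := mul_le_mul_of_nonneg_left h.le lo.coe_nonneg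
          have h3 := mul_le_mul_of_nonneg_right hle' ha
          have h4 := mul_le_mul_of_nonneg_right hle' hη.le
          linarith
        · have h2 := mul_le_mul_of_nonneg_left h.le hi.coe_nonneg
          have h3 := mul_le_mul_of_nonneg_right hle' hb
          linarith
      have := mul_le_mul_of_nonneg_right h1 hr
      simp only [hVdef]
      linarith
  obtain ⟨ϖ, v, -, hv, hag, hc, h⟩ := exists_path_of_jump_or_wait hB (norm_nonneg g) hVL hVM
    (by positivity) hV hω (by exact_mod_cast le_self_add)
  have hv : v ≤ u + δ := by exact_mod_cast hv
  refine ⟨ϖ, hag, fun x hx => by rw [hc x (hv.trans hx), hc _ hv], ?_⟩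
  have := h (u + δ) hv le_rfl
  simp only [hVdef] at this
  push_cast at this
  rw [eulerStep_apply]
  linarith

/-- The adversary's play up to the time at which `g` is evaluated, by concatenation of `p` Euler
steps. -/
theorem exists_path_iterate_eulerStep {lo hi : ℝ≥0} (hle : lo ≤ hi) {G : OneSidedStrategy} {c : ℝ}
    {B : ℝ} (hB : ∀ t ω, B ≤ capital lo hi G c t ω) (g : ℕ →ᵇ ℝ) {δ : ℝ≥0} {η : ℝ} (hη : 0 < η)
    (p : ℕ) (hg : ∀ q < p, 4 * δ * ‖generator lo hi ((eulerStep lo hi δ)^[q] g)‖ ≤ η)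
    {u : ℝ≥0} {ω : CountingPath} (hω : ∀ x, u ≤ x → ω x = ω u) :
    ∃ ϖ : CountingPath, AgreeUpTo u ϖ ω ∧ (∀ x, u + p * δ ≤ x → ϖ x = ϖ (u + p * δ)) ∧
      (eulerStep lo hi δ)^[p] g (ω u) - capital lo hi G c u ω - hi * η * (p * δ)
        ≤ g (ϖ (u + p * δ)) - capital lo hi G c (u + p * δ) ϖ := by
  induction p generalizing u ω with
  | zero => exact ⟨ω, fun _ _ => rfl, by simpa using hω, by simp⟩
  | succ p ih =>
    obtain ⟨ϖ, hag, hc, h⟩ := exists_path_eulerStep hle hB ((eulerStep lo hi δ)^[p] g) hη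
      (hg p (Nat.lt_succ_self p)) hω
    obtain ⟨ϖ', hag', hc', h'⟩ := ih (fun q hq => hg q (hq.trans (Nat.lt_succ_self p))) hc
    have e : u + δ + p * δ = u + (p + 1 : ℕ) * δ := by push_cast; ring
    rw [e] at hc' h'
    refine ⟨ϖ', (hag'.mono (by exact_mod_cast le_self_add)).trans hag, hc', ?_⟩
    rw [Function.iterate_succ_apply']
    push_cast at h' ⊢
    linarith

/-- From any time on, the adversary can prevent any further gains: with target value zero,
jumping is profitable whenever the lower stake exceeds the upper one, and otherwise waiting is. -/
theorem exists_path_capital_le {lo hi : ℝ≥0} (hle : lo ≤ hi) {G : OneSidedStrategy} {c : ℝ}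
    {B : ℝ} (hB : ∀ t ω, B ≤ capital lo hi G c t ω) {u : ℝ≥0} {ω : CountingPath}
    (hω : ∀ x, u ≤ x → ω x = ω u) :
    ∃ (ϖ : CountingPath) (v : ℝ≥0), AgreeUpTo u ϖ ω ∧
      ∀ r, v ≤ r → capital lo hi G c r ϖ ≤ capital lo hi G c u ω := by
  have hV : ∀ a b : ℝ, 0 ≤ a → 0 ≤ b → ∃ θ : ℝ, 0 < θ ∧ ∀ _ : ℕ,
      (∀ r, u ≤ r → (r : ℝ≥0∞) ≤ ⊤ → 0 + (a - b) + θ ≤ 0) ∨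
      ∀ r r' : ℝ≥0, u ≤ r → r ≤ r' → (r' : ℝ≥0∞) ≤ ⊤ →
        0 - 0 * ((r' : ℝ) - r) ≤ 0 + (hi * a - lo * b) * ((r' : ℝ) - r) := by
    intro a b ha hb
    have hle' : (lo : ℝ) ≤ hi := hle
    rcases lt_or_ge a b with hab | hab
    · exact ⟨b - a, sub_pos.2 hab, fun m => Or.inl fun r _ _ => by linarith⟩
    · refine ⟨1, one_pos, fun m => Or.inr fun r r' _ hr _ => ?_⟩
      have hr : (0 : ℝ) ≤ (r' : ℝ) - r := sub_nonneg.2 (by exact_mod_cast hr)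
      have : 0 ≤ (hi : ℝ) * a - lo * b :=
        sub_nonneg.2 (mul_le_mul hle' hab hb hi.coe_nonneg)
      have := mul_nonneg this hr
      linarith
  obtain ⟨ϖ, v, -, -, hag, -, h⟩ := exists_path_of_jump_or_wait hB (V := fun _ _ => 0) (L := 0)
    (M := 0) le_rfl (by simp) (by simp) le_rfl hV hω le_top
  exact ⟨ϖ, v, hag, fun r hr => by simpa using h r hr le_top⟩

/-! ### The first jump in an interval -/

/-- The time of the first jump of `ω` after `a`, or `b` if there is no jump in `(a, b]`. -/
noncomputable def firstJump (a b : ℝ≥0) (ω : CountingPath) : ℝ≥0 :=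
  sInf (insert b {x | ω a < ω x})

section firstJump

variable {a b : ℝ≥0} {ω : CountingPath}

theorem firstJump_le (a b : ℝ≥0) (ω : CountingPath) : firstJump a b ω ≤ b :=
  csInf_le (OrderBot.bddBelow _) (Set.mem_insert _ _)

theorem le_firstJump (hab : a ≤ b) (ω : CountingPath) : a ≤ firstJump a b ω := by
  refine le_csInf ⟨b, Set.mem_insert _ _⟩ ?_
  rintro x (rfl | hx)
  · exact hab
  · exact (ω.monotone'.reflect_lt hx).le

theorem apply_le_of_lt_firstJump {x : ℝ≥0} (hx : x < firstJump a b ω) : ω x ≤ ω a :=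
  not_lt.1 fun h => notMem_of_lt_csInf hx (OrderBot.bddBelow _) (Set.mem_insert_of_mem _ h)

theorem apply_firstJump_le (hab : a ≤ b) (ω : CountingPath) : ω (firstJump a b ω) ≤ ω a + 1 := by
  rcases (le_firstJump hab ω).eq_or_lt with h | h
  · rw [← h]
    exact Nat.le_succ _
  · have : (𝓝[<] firstJump a b ω).NeBot := nhdsLT_neBot_of_exists_lt ⟨a, h⟩
    obtain ⟨x, hx, hx'⟩ := ((ω.unitJumps' (firstJump a b ω)).and self_mem_nhdsWithin).exists
    exact hx.trans (Nat.succ_le_succ (apply_le_of_lt_firstJump hx'))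

theorem lt_apply_firstJump (hT : firstJump a b ω < b) : ω a < ω (firstJump a b ω) := by
  by_contra! h
  -- By right-continuity, there would be no jump shortly after the infimum either.
  have h1 : ∀ᶠ x in 𝓝[≥] (firstJump a b ω), ω x = ω (firstJump a b ω) :=
    (ω.rightContinuous' (firstJump a b ω)).eventually_mem
      (isOpen_discrete {ω (firstJump a b ω)} |>.mem_nhds rfl)
  obtain ⟨z, hz, hz'⟩ := (mem_nhdsGE_iff_exists_Ico_subset' hT).1 h1
  have hz : firstJump a b ω < z := hz
  obtain ⟨x, hx, hxz⟩ := exists_lt_of_csInf_lt ⟨b, Set.mem_insert b {x | ω a < ω x}⟩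
    (show firstJump a b ω < min z b from lt_min hz hT)
  rcases hx with rfl | hx
  · exact absurd hxz (not_lt.2 (min_le_right _ _))
  · have h2 : firstJump a b ω ≤ x :=
      csInf_le (OrderBot.bddBelow _) (Set.mem_insert_of_mem _ hx)
    have h3 : ω x = ω (firstJump a b ω) := hz' ⟨h2, hxz.trans_le (min_le_left _ _)⟩
    have hx : ω a < ω x := hx
    omega

theorem isStoppingTime_firstJump (hab : a ≤ b) :
    IsStoppingTime (fun ω => (firstJump a b ω : ℝ≥0∞)) := by
  intro ω₁ ω₂ h
  have h : ∀ x ≤ firstJump a b ω₁, ω₁ x = ω₂ x := fun x hx =>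
    h x (ENNReal.coe_le_coe.2 hx)
  have ha := h a (le_firstJump hab ω₁)
  refine congrArg _ (le_antisymm ?_ ?_)
  · refine le_csInf ⟨b, Set.mem_insert _ _⟩ ?_
    rintro x (rfl | hx)
    · exact firstJump_le _ _ _
    · by_contra! hlt
      have hx : ω₂ a < ω₂ x := hx
      have := apply_le_of_lt_firstJump hlt
      rw [h x hlt.le, ha] at this
      omega
  · rcases (firstJump_le a b ω₁).eq_or_lt with hT | hT
    · exact (firstJump_le a b ω₂).trans hT.ge
    · refine csInf_le (OrderBot.bddBelow _) (Set.mem_insert_of_mem _ ?_)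
      change ω₂ a < ω₂ _
      rw [← ha, ← h _ le_rfl]
      exact lt_apply_firstJump hT

end firstJump

/-! ### The hedging strategy -/

/-- The stopping times of the hedging strategy: at even indices the grid points `s + j * δ`, and in
between the first jump times in the grid intervals. -/
noncomputable def hedgeTime (s δ : ℝ≥0) (i : ℕ) (ω : CountingPath) : ℝ≥0 :=
  if Even i then s + (i / 2 : ℕ) * δ
  else firstJump (s + (i / 2 : ℕ) * δ) (s + (i / 2 + 1 : ℕ) * δ) ω

theorem hedgeTime_two_mul (s δ : ℝ≥0) (j : ℕ) (ω : CountingPath) :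
    hedgeTime s δ (2 * j) ω = s + j * δ := by
  simp [hedgeTime]

theorem hedgeTime_two_mul_add_one (s δ : ℝ≥0) (j : ℕ) (ω : CountingPath) :
    hedgeTime s δ (2 * j + 1) ω = firstJump (s + j * δ) (s + (j + 1 : ℕ) * δ) ω := by
  simp [hedgeTime, show (2 * j + 1) / 2 = j by omega]

theorem hedgeTime_two_mul_add_two (s δ : ℝ≥0) (j : ℕ) (ω : CountingPath) :
    hedgeTime s δ (2 * j + 1 + 1) ω = s + (j + 1 : ℕ) * δ :=
  hedgeTime_two_mul s δ (j + 1) ω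

theorem grid_le (s δ : ℝ≥0) (j : ℕ) : s + j * δ ≤ s + (j + 1 : ℕ) * δ := by
  gcongr
  exact Nat.le_succ j

theorem hedgeTime_mono (s δ : ℝ≥0) (ω : CountingPath) : Monotone fun i => hedgeTime s δ i ω := by
  refine monotone_nat_of_le_succ fun i => ?_
  obtain ⟨j, rfl | rfl⟩ := Nat.even_or_odd' i
  · rw [hedgeTime_two_mul, hedgeTime_two_mul_add_one]
    exact le_firstJump (grid_le s δ j) ω
  · rw [hedgeTime_two_mul_add_one, hedgeTime_two_mul_add_two]
    exact firstJump_le _ _ _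

theorem isStoppingTime_hedgeTime (s δ : ℝ≥0) (i : ℕ) :
    IsStoppingTime (fun ω => (hedgeTime s δ i ω : ℝ≥0∞)) := by
  obtain ⟨j, rfl | rfl⟩ := Nat.even_or_odd' i
  · intro _ _ _
    simp only [hedgeTime_two_mul]
  · simp only [hedgeTime_two_mul_add_one]
    exact isStoppingTime_firstJump (grid_le s δ j)

/-- The change of `w` that a jump at the grid point `s + j * δ` causes. -/
noncomputable def jumpDiff (s δ : ℝ≥0) (w : ℕ →ᵇ ℝ) (j : ℕ) (ω : CountingPath) : ℝ :=
  w (ω (s + j * δ) + 1) - w (ω (s + j * δ))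

theorem abs_jumpDiff_le (s δ : ℝ≥0) (w : ℕ →ᵇ ℝ) (j : ℕ) (ω : CountingPath) :
    |jumpDiff s δ w j ω| ≤ 2 * ‖w‖ := abs_sub_apply_le w _ _

/-- The strategy that hedges the values `w j` at the grid points `s + (j + 1) * δ` for `j < k`. In
each grid interval it replicates the first jump; after that it bets the amount `A` on further jumps.
The extra upper stake `β` pays for what is lost in the intervals with a jump. -/
noncomputable def hedge (s δ : ℝ≥0) (k : ℕ) (w : ℕ → ℕ →ᵇ ℝ) (A β : ℝ) (hA : 0 ≤ A) (hβ : 0 ≤ β) :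
    OneSidedStrategy where
  n := 2 * k
  τ i ω := hedgeTime s δ i ω
  upperStake i ω := (if Even i then max (jumpDiff s δ (w (i / 2)) (i / 2) ω) 0 else A) + β
  lowerStake i ω := if Even i then max (-jumpDiff s δ (w (i / 2)) (i / 2) ω) 0 else 0
  isStoppingTime i _ := isStoppingTime_hedgeTime s δ i
  increasing i _ ω := ENNReal.coe_le_coe.2 (hedgeTime_mono s δ ω (Nat.le_succ i))
  upperStake_nonneg i _ ω _ := by
    split_ifs <;> positivity
  lowerStake_nonneg i _ ω _ := by
    split_ifs <;> positivity
  upperStake_bounded i _ := by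
    refine ⟨2 * ‖w (i / 2)‖ + A + β, fun ω _ => ?_⟩
    have h := (abs_le.1 (abs_jumpDiff_le s δ (w (i / 2)) (i / 2) ω)).2
    have h' := norm_nonneg (w (i / 2))
    gcongr
    split_ifs
    · exact max_le (by linarith) (by linarith)
    · linarith
  lowerStake_bounded i _ := by
    refine ⟨2 * ‖w (i / 2)‖, fun ω _ => ?_⟩
    have h := (abs_le.1 (abs_jumpDiff_le s δ (w (i / 2)) (i / 2) ω)).1
    have h' := norm_nonneg (w (i / 2))
    split_ifs
    · exact max_le (by linarith) (by linarith)
    · linarith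
  upperStake_measurable i _ := by
    intro ω₁ _ ω₂ _ h
    obtain ⟨j, rfl | rfl⟩ := Nat.even_or_odd' i
    · simp only [hedgeTime_two_mul] at h
      simp [jumpDiff, h _ le_rfl]
    · simp
  lowerStake_measurable i _ := by
    intro ω₁ _ ω₂ _ h
    obtain ⟨j, rfl | rfl⟩ := Nat.even_or_odd' i
    · simp only [hedgeTime_two_mul] at h
      simp [jumpDiff, h _ le_rfl]
    · simp

theorem generator_apply_eq {lo hi : ℝ≥0} (hle : lo ≤ hi) (w : ℕ →ᵇ ℝ) (m : ℕ) :
    generator lo hi w m = hi * max (w (m + 1) - w m) 0 - lo * max (-(w (m + 1) - w m)) 0 := by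
  have hle' : (lo : ℝ) ≤ hi := hle
  rw [generator_apply]
  rcases le_total 0 (w (m + 1) - w m) with h | h
  · rw [max_eq_right (mul_le_mul_of_nonneg_right hle' h), max_eq_left h,
      max_eq_right (neg_nonpos.2 h)]
    ring
  · rw [max_eq_left (mul_le_mul_of_nonpos_right hle' h), max_eq_right h,
      max_eq_left (neg_nonneg.2 h)]
    ring

/-- The gain of the hedging strategy in a grid interval that starts in the state `m`, has its first
jump (to the state `p`) after a time `ℓ` and ends in the state `q`. If there is no jump, then
`ℓ = δ` and `p = m`. The stake `4 * hi * C * δ` is earned at the first jump; one half of it covers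
the price of the bet on further jumps, the other half the difference between the drifts up to
time `ℓ` and up to time `δ`. -/
theorem le_hedge_gain {lo hi : ℝ≥0} (hle : lo ≤ hi) {w : ℕ →ᵇ ℝ} {C δ ℓ : ℝ} (hw : ‖w‖ ≤ C)
    (hℓ : 0 ≤ ℓ) (hℓδ : ℓ ≤ δ) {m p q : ℕ} (hmp : m ≤ p) (hpm : p ≤ m + 1) (hpq : p ≤ q)
    (h : ℓ = δ ∧ q = p ∨ m < p) :
    w q - eulerStep lo hi δ w m - 4 * hi * C * δ * hi * δ ≤
      (max (w (m + 1) - w m) 0 + 4 * hi * C * δ) * (((p : ℝ) - m) - hi * ℓ)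
        + max (-(w (m + 1) - w m)) 0 * (lo * ℓ - ((p : ℝ) - m))
      + (2 * C + 4 * hi * C * δ) * (((q : ℝ) - p) - hi * (δ - ℓ)) := by
  have hC : 0 ≤ C := (norm_nonneg w).trans hw
  have hδ : 0 ≤ δ := hℓ.trans hℓδ
  have hG := generator_apply_eq hle w m
  have hGn : |generator lo hi w m| ≤ 2 * hi * C :=
    ((generator lo hi w).norm_coe_le_norm m).trans ((norm_generator_le hle w).trans (by gcongr))
  have hh : max (w (m + 1) - w m) 0 - max (-(w (m + 1) - w m)) 0 = w (m + 1) - w m := by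
    rcases le_total 0 (w (m + 1) - w m) with h | h
    · rw [max_eq_left h, max_eq_right (neg_nonpos.2 h)]; ring
    · rw [max_eq_right h, max_eq_left (neg_nonneg.2 h)]; ring
  rw [eulerStep_apply]
  set U := max (w (m + 1) - w m) 0
  set D := max (-(w (m + 1) - w m)) 0
  set g := generator lo hi w m
  have hβ : 0 ≤ 4 * hi * C * δ := by positivity
  rcases (show p = m ∨ p = m + 1 by omega) with rfl | rfl
  · obtain ⟨rfl, rfl⟩ := h.resolve_right (lt_irrefl _)
    rw [hG]
    linarith
  · obtain ⟨d, rfl⟩ := Nat.exists_eq_add_of_le hpq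
    push_cast
    have h1 : w (m + 1 + d) - w (m + 1) ≤ 2 * C * d := by
      rcases Nat.eq_zero_or_pos d with rfl | hd
      · simp
      · have h2 := (abs_le.1 (abs_sub_apply_le w (m + 1 + d) (m + 1))).2
        have h3 : (1 : ℝ) ≤ d := by exact_mod_cast hd
        have h4 : C * 1 ≤ C * d := mul_le_mul_of_nonneg_left h3 hC
        linarith
    have h2 : 0 ≤ 4 * hi * C * δ * d := by positivity
    have h3 : (δ - ℓ) * (2 * C * hi - g) ≤ δ * (4 * hi * C) := by
      have := (abs_le.1 hGn).1
      have := (abs_le.1 hGn).2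
      have : 0 ≤ hi * C := by positivity
      calc (δ - ℓ) * (2 * C * hi - g) ≤ (δ - ℓ) * (4 * hi * C) :=
            mul_le_mul_of_nonneg_left (by linarith) (by linarith)
        _ ≤ _ := mul_le_mul_of_nonneg_right (by linarith) (by linarith)
    rw [hG] at h3 ⊢
    linear_combination h1 + h2 + h3 - hh

theorem sum_range_two_mul (f : ℕ → ℝ) (k : ℕ) :
    ∑ i ∈ Finset.range (2 * k), f i = ∑ j ∈ Finset.range k, (f (2 * j) + f (2 * j + 1)) := by
  induction k with
  | zero => simp
  | succ k ih =>
    rw [show 2 * (k + 1) = 2 * k + 1 + 1 by ring, Finset.sum_range_succ, Finset.sum_range_succ, ih,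
      Finset.sum_range_succ, add_assoc]

theorem capital_hedge (lo hi s δ : ℝ≥0) (k : ℕ) (w : ℕ → ℕ →ᵇ ℝ) (A β : ℝ) (hA : 0 ≤ A)
    (hβ : 0 ≤ β) (c : ℝ) (t : ℝ≥0) (ω : CountingPath) :
    capital lo hi (hedge s δ k w A β hA hβ) c t ω = c + ∑ j ∈ Finset.range k,
      ((max (jumpDiff s δ (w j) j ω) 0 + β) *
          (((ω (min (hedgeTime s δ (2 * j + 1) ω) t) : ℝ) - ω (min (s + j * δ) t))
            - hi * (((min (hedgeTime s δ (2 * j + 1) ω) t : ℝ≥0) : ℝ)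
              - (min (s + j * δ) t : ℝ≥0)))
        + max (-jumpDiff s δ (w j) j ω) 0 *
          (lo * (((min (hedgeTime s δ (2 * j + 1) ω) t : ℝ≥0) : ℝ) - (min (s + j * δ) t : ℝ≥0))
            - ((ω (min (hedgeTime s δ (2 * j + 1) ω) t) : ℝ) - ω (min (s + j * δ) t)))
        + (A + β) *
          (((ω (min (s + (j + 1 : ℕ) * δ) t) : ℝ) - ω (min (hedgeTime s δ (2 * j + 1) ω) t))
            - hi * (((min (s + (j + 1 : ℕ) * δ) t : ℝ≥0) : ℝ)
              - (min (hedgeTime s δ (2 * j + 1) ω) t : ℝ≥0)))) := by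
  rw [capital]
  simp only [hedge, stopAt_coe]
  rw [sum_range_two_mul]
  congr 1
  refine Finset.sum_congr rfl fun j _ => ?_
  have h1 : ¬ Even (2 * j + 1) := by simp
  have h2 : (2 * j) / 2 = j := by omega
  simp only [h1, even_two_mul, if_true, if_false, h2, hedgeTime_two_mul,
    hedgeTime_two_mul_add_two, zero_mul, add_zero]

theorem boundedBelow_capital_hedge (lo hi s δ : ℝ≥0) (k : ℕ) (w : ℕ → ℕ →ᵇ ℝ) (A β : ℝ)
    (hA : 0 ≤ A) (hβ : 0 ≤ β) (c : ℝ) :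
    BoundedBelow (capital lo hi (hedge s δ k w A β hA hβ) c) := by
  refine ⟨c + ∑ j ∈ Finset.range k,
    (-((2 * ‖w j‖ + β) * (hi * δ)) - 2 * ‖w j‖ - (A + β) * (hi * δ)), fun t ω => ?_⟩
  rw [capital_hedge]
  gcongr with j _
  -- The times `x ≤ y ≤ z` delimit the two bets in the grid interval, stopped at time `t`.
  have hT1 : s + j * δ ≤ hedgeTime s δ (2 * j + 1) ω := by
    simpa [hedgeTime_two_mul] using hedgeTime_mono s δ ω (Nat.le_succ (2 * j))
  have hT2 : hedgeTime s δ (2 * j + 1) ω ≤ s + (j + 1 : ℕ) * δ := by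
    simpa [hedgeTime_two_mul_add_two] using hedgeTime_mono s δ ω (Nat.le_succ (2 * j + 1))
  have hz : s + (j + 1 : ℕ) * δ = s + j * δ + δ := by push_cast; ring
  have hyx : min (hedgeTime s δ (2 * j + 1) ω) t ≤ min (s + j * δ) t + δ := by
    rcases le_total (s + j * δ) t with h | h
    · rw [min_eq_left h, ← hz]
      exact (min_le_left _ _).trans hT2
    · rw [min_eq_right h]
      exact (min_le_right _ _).trans (le_add_of_nonneg_right δ.2)
  have hzy : min (s + (j + 1 : ℕ) * δ) t ≤ min (hedgeTime s δ (2 * j + 1) ω) t + δ := by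
    rcases le_total (hedgeTime s δ (2 * j + 1) ω) t with h | h
    · rw [min_eq_left h, hz]
      exact (min_le_left _ _).trans (by gcongr)
    · rw [min_eq_right h]
      exact (min_le_right _ _).trans (le_add_of_nonneg_right δ.2)
  have hjump : ω (min (hedgeTime s δ (2 * j + 1) ω) t) ≤ ω (min (s + j * δ) t) + 1 := by
    rcases le_total (s + j * δ) t with h | h
    · rw [min_eq_left h]
      refine (ω.monotone' (min_le_left _ _)).trans ?_
      rw [hedgeTime_two_mul_add_one]
      exact apply_firstJump_le (grid_le s δ j) ω
    · rw [min_eq_right h, min_eq_right (h.trans hT1)]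
      exact Nat.le_succ _
  have hxy : min (s + j * δ) t ≤ min (hedgeTime s δ (2 * j + 1) ω) t := min_le_min_right t hT1
  have hyz : min (hedgeTime s δ (2 * j + 1) ω) t ≤ min (s + (j + 1 : ℕ) * δ) t :=
    min_le_min_right t hT2
  set x := min (s + j * δ) t
  set y := min (hedgeTime s δ (2 * j + 1) ω) t
  set z := min (s + (j + 1 : ℕ) * δ) t
  have n1 : (ω x : ℝ) ≤ ω y := by exact_mod_cast ω.monotone' hxy
  have n2 : (ω y : ℝ) ≤ ω x + 1 := by exact_mod_cast hjump
  have n3 : (ω y : ℝ) ≤ ω z := by exact_mod_cast ω.monotone' hyz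
  have t1 : (y : ℝ) ≤ x + δ := by exact_mod_cast hyx
  have t2 : (z : ℝ) ≤ y + δ := by exact_mod_cast hzy
  have t3 : (x : ℝ) ≤ y := by exact_mod_cast hxy
  have h := abs_le.1 (abs_jumpDiff_le s δ (w j) j ω)
  have hU : max (jumpDiff s δ (w j) j ω) 0 ≤ 2 * ‖w j‖ := max_le h.2 (by positivity)
  have hD : max (-jumpDiff s δ (w j) j ω) 0 ≤ 2 * ‖w j‖ := max_le (by linarith) (by positivity)
  have hU0 := le_max_right (jumpDiff s δ (w j) j ω) 0
  have hD0 := le_max_right (-jumpDiff s δ (w j) j ω) 0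
  have key : ∀ S S' n ℓ : ℝ, 0 ≤ S → S ≤ S' → 0 ≤ n → ℓ ≤ δ →
      -(S' * (hi * δ)) ≤ S * (n - hi * ℓ) := by
    intro S S' n ℓ hS hSS' hn hℓ
    have e1 : S * (hi * ℓ) ≤ S' * (hi * δ) :=
      (mul_le_mul_of_nonneg_left (mul_le_mul_of_nonneg_left hℓ hi.coe_nonneg) hS).trans
        (mul_le_mul_of_nonneg_right hSS' (by positivity))
    have e2 := mul_nonneg hS hn
    linarith
  have k1 := key (max (jumpDiff s δ (w j) j ω) 0 + β) (2 * ‖w j‖ + β) (ω y - ω x) (y - x)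
    (by linarith) (by linarith) (by linarith) (by linarith)
  have k2 := key (A + β) (A + β) (ω z - ω y) (z - y) (by linarith) le_rfl (by linarith)
    (by linarith)
  have k3 : -(2 * ‖w j‖) ≤ max (-jumpDiff s δ (w j) j ω) 0 * (lo * (y - x) - (ω y - ω x)) := by
    have e1 : 0 ≤ max (-jumpDiff s δ (w j) j ω) 0 * (lo * ((y : ℝ) - x)) :=
      mul_nonneg hD0 (mul_nonneg lo.coe_nonneg (by linarith))
    have e2 : max (-jumpDiff s δ (w j) j ω) 0 * ((ω y : ℝ) - ω x) ≤ 2 * ‖w j‖ * 1 :=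
      mul_le_mul hD (by linarith) (by linarith) (by positivity)
    linarith
  linarith

theorem capital_hedge_start (lo hi s δ : ℝ≥0) (k : ℕ) (w : ℕ → ℕ →ᵇ ℝ) (A β : ℝ) (hA : 0 ≤ A)
    (hβ : 0 ≤ β) (c : ℝ) (ω : CountingPath) :
    capital lo hi (hedge s δ k w A β hA hβ) c s ω = c := by
  rw [capital_hedge, Finset.sum_eq_zero, add_zero]
  intro j _
  have h : ∀ i, s ≤ hedgeTime s δ i ω := fun i => by
    simpa [hedgeTime] using hedgeTime_mono s δ ω (Nat.zero_le i)
  have h1 : min (s + (j + 1 : ℕ) * δ) s = s := min_eq_right (le_add_of_nonneg_right bot_le)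
  have h2 : min (s + j * δ) s = s := min_eq_right (le_add_of_nonneg_right bot_le)
  rw [min_eq_right (h _), h1, h2]
  ring

/-- The hedging strategy for the iterates of the Euler step superhedges `g`. -/
theorem le_capital_hedge {lo hi : ℝ≥0} (hle : lo ≤ hi) (s δ : ℝ≥0) (k : ℕ) (g : ℕ →ᵇ ℝ) {C : ℝ}
    (hC : 0 ≤ C) (hg : ∀ q < k, ‖(eulerStep lo hi δ)^[q] g‖ ≤ C) (c : ℝ) {t : ℝ≥0}
    (ht : s + k * δ ≤ t) (ω : CountingPath) :
    c + g (ω (s + k * δ)) - (eulerStep lo hi δ)^[k] g (ω s) - k * (4 * hi * C * δ * hi * δ) ≤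
      capital lo hi (hedge s δ k (fun j => (eulerStep lo hi δ)^[k - (j + 1)] g) (2 * C)
        (4 * hi * C * δ) (by positivity) (by positivity)) c t ω := by
  set v : ℕ → ℕ →ᵇ ℝ := fun j => (eulerStep lo hi δ)^[k - j] g with hv
  have hsum : ∑ j ∈ Finset.range k, (v (j + 1) (ω (s + (j + 1 : ℕ) * δ)) - v j (ω (s + j * δ))
      - 4 * hi * C * δ * hi * δ)
      = g (ω (s + k * δ)) - (eulerStep lo hi δ)^[k] g (ω s) - k * (4 * hi * C * δ * hi * δ) := by
    rw [Finset.sum_sub_distrib, Finset.sum_range_sub (fun j => v j (ω (s + j * δ)))]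
    simp [hv]
  rw [capital_hedge, add_sub_assoc, add_sub_assoc, ← hsum]
  gcongr with j hj
  have hj := Finset.mem_range.1 hj
  have hab := grid_le s δ j
  have hbt : s + (j + 1 : ℕ) * δ ≤ t := by
    refine le_trans ?_ ht
    gcongr
    omega
  have hz : ((s + (j + 1 : ℕ) * δ : ℝ≥0) : ℝ) = (s + j * δ : ℝ≥0) + δ := by push_cast; ring
  rw [hedgeTime_two_mul_add_one]
  have hT1 := le_firstJump hab ω
  have hT2 := firstJump_le (s + j * δ) (s + (j + 1 : ℕ) * δ) ω
  rw [min_eq_left hbt, min_eq_left (hab.trans hbt), min_eq_left (hT2.trans hbt)]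
  have hstep : v j = eulerStep lo hi δ (v (j + 1)) := by
    simp only [hv]
    rw [show k - j = (k - (j + 1)) + 1 by omega, Function.iterate_succ_apply']
  have hjump := apply_firstJump_le hab ω
  have hcase := @lt_apply_firstJump (s + j * δ) (s + (j + 1 : ℕ) * δ) ω
  rw [hstep]
  unfold jumpDiff
  set b := s + (j + 1 : ℕ) * δ
  set a := s + j * δ
  set T := firstJump a b ω
  have hT1' : (a : ℝ) ≤ T := by exact_mod_cast hT1
  have hT2' : (T : ℝ) ≤ b := by exact_mod_cast hT2
  have := le_hedge_gain hle (hg (k - (j + 1)) (by omega)) (δ := δ) (ℓ := (T : ℝ) - a)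
    (sub_nonneg.2 hT1') (by linarith) (ω.monotone' hT1) hjump (ω.monotone' hT2) (by
      rcases hT2.eq_or_lt with h | h
      · left
        rw [h]
        exact ⟨by linarith, rfl⟩
      · exact Or.inr (hcase h))
  rwa [show (δ : ℝ) - (T - a) = b - T by linarith] at this

/-! ### The two bounds for the upper expectation -/

theorem upperExpectation_le {lo hi : ℝ≥0} (hle : lo ≤ hi) (s δ : ℝ≥0) (k : ℕ) (g : ℕ →ᵇ ℝ) {C : ℝ}
    (hC : 0 ≤ C) (hg : ∀ q < k, ‖(eulerStep lo hi δ)^[q] g‖ ≤ C) (ω : CountingPath) :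
    upperExpectation (oneSidedCapitalProcesses lo hi) (fun _ => (s : ℝ≥0∞))
        (fun ϖ => ((g (coord (s + k * δ) ϖ) : ℝ) : EReal)) ω
      ≤ (((eulerStep lo hi δ)^[k] g (ω s) + k * (4 * hi * C * δ * hi * δ) : ℝ) : EReal) := by
  set c := (eulerStep lo hi δ)^[k] g (ω s) + k * (4 * hi * C * δ * hi * δ) with hc
  set G := hedge s δ k (fun j => (eulerStep lo hi δ)^[k - (j + 1)] g) (2 * C)
    (4 * hi * C * δ) (by positivity) (by positivity) with hG
  refine sInf_le ⟨capital lo hi G c, ⟨G, c, rfl⟩, boundedBelow_capital_hedge .., ?_, ?_⟩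
  · intro ϖ hϖ
    refine le_liminf_of_le (by isBoundedDefault) ?_
    filter_upwards [eventually_ge_atTop (s + k * δ)] with t ht
    have h := le_capital_hedge hle s δ k g hC hg c ht ϖ
    have hs : ϖ s = ω s := hϖ s le_rfl
    rw [hs] at h
    refine EReal.coe_le_coe_iff.2 (le_trans (le_of_eq ?_) h)
    rw [hc, coord]
    ring
  · rw [ENNReal.toNNReal_coe, hG, capital_hedge_start]

theorem le_upperExpectation {lo hi : ℝ≥0} (hle : lo ≤ hi) (s δ : ℝ≥0) (k : ℕ) (g : ℕ →ᵇ ℝ) {η : ℝ}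
    (hη : 0 < η) (hg : ∀ q < k, 4 * δ * ‖generator lo hi ((eulerStep lo hi δ)^[q] g)‖ ≤ η)
    (ω : CountingPath) :
    (((eulerStep lo hi δ)^[k] g (ω s) - hi * η * (k * δ) : ℝ) : EReal) ≤
      upperExpectation (oneSidedCapitalProcesses lo hi) (fun _ => (s : ℝ≥0∞))
        (fun ϖ => ((g (coord (s + k * δ) ϖ) : ℝ) : EReal)) ω := by
  refine le_sInf ?_
  rintro x ⟨-, ⟨G, c, rfl⟩, ⟨B, hB⟩, hf, rfl⟩
  rw [ENNReal.toNNReal_coe, EReal.coe_le_coe_iff]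
  have hfreeze : AgreeUpTo s (ω.freeze s) ω := fun x hx => by
    have hx : x ≤ s := by exact_mod_cast hx
    change ω (min x s) = ω x
    rw [min_eq_left hx]
  have hconst : ∀ x, s ≤ x → ω.freeze s x = ω.freeze s s := fun x hx => by
    change ω (min x s) = ω (min s s)
    rw [min_eq_right hx, min_self]
  obtain ⟨ϖ, hag, hc, h⟩ := exists_path_iterate_eulerStep hle hB g hη k hg hconst
  obtain ⟨ϖ', v, hag', h'⟩ := exists_path_capital_le hle hB hc
  have hmem : AgreeUpTo s ϖ' ω :=
    ((hag'.mono (by exact_mod_cast le_self_add)).trans hag).trans hfreeze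
  have h1 := (hf ϖ' hmem).trans (liminf_le_liminf (v := fun _ =>
    ((capital lo hi G c (s + k * δ) ϖ : ℝ) : EReal)) (by
      filter_upwards [eventually_ge_atTop v] with r hr
      exact EReal.coe_le_coe_iff.2 (h' r hr)))
  rw [liminf_const, EReal.coe_le_coe_iff, coord, hag' _ le_rfl] at h1
  rw [capital_eq_of_agreeUpTo lo hi G c hfreeze, hfreeze s le_rfl] at h
  linarith

theorem eulerApprox_eq (lo hi Δ : ℝ≥0) (k : ℕ) :
    eulerApprox lo hi Δ k = (eulerStep lo hi ((Δ / k : ℝ≥0) : ℝ))^[k] := by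
  rw [eulerApprox, NNReal.coe_div, NNReal.coe_natCast]
  rfl

/-- The upper expectation differs from the `k`-th Euler approximation by `O(1 / k)`, uniformly on
bounded sets of functions and over all states. -/
theorem exists_upperExpectation_bounds {lo hi : ℝ≥0} (hle : lo ≤ hi) (Δ : ℝ≥0) (R : ℝ) :
    ∃ M : ℝ, 0 ≤ M ∧ ∀ (g : ℕ →ᵇ ℝ), ‖g‖ ≤ R → ∀ (s : ℝ≥0) (ω : CountingPath) (k : ℕ), 1 ≤ k →
      ((eulerApprox lo hi Δ k g (ω s) - M / k : ℝ) : EReal) ≤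
        upperExpectation (oneSidedCapitalProcesses lo hi) (fun _ => (s : ℝ≥0∞))
          (fun ϖ => ((g (coord (s + Δ) ϖ) : ℝ) : EReal)) ω ∧
      upperExpectation (oneSidedCapitalProcesses lo hi) (fun _ => (s : ℝ≥0∞))
          (fun ϖ => ((g (coord (s + Δ) ϖ) : ℝ) : EReal)) ω ≤
        ((eulerApprox lo hi Δ k g (ω s) + M / k : ℝ) : EReal) := by
  rcases lt_or_ge R 0 with hR | hR
  · exact ⟨0, le_rfl, fun g hg => absurd (hg.trans_lt hR) (not_lt.2 (norm_nonneg g))⟩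
  -- A bound for the norms of all iterates of the Euler step.
  set C := Real.exp (2 * hi * Δ) * R with hCdef
  have hC : 0 ≤ C := by positivity
  refine ⟨hi * Δ * (8 * hi * C * Δ + 1), by positivity, fun g hg s ω k hk => ?_⟩
  set δ : ℝ≥0 := Δ / k with hδ
  have hk0 : (k : ℝ≥0) ≠ 0 := by positivity
  have hk0' : (0 : ℝ) < k := by positivity
  have hkδ : (k : ℝ≥0) * δ = Δ := mul_div_cancel₀ Δ hk0
  have hkδ' : (k : ℝ) * δ = Δ := by exact_mod_cast hkδ
  have hδ' : (δ : ℝ) = Δ / k := by rw [hδ]; push_cast; rfl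
  have hnorm : ∀ q < k, ‖(eulerStep lo hi δ)^[q] g‖ ≤ C := fun q hq => by
    refine (norm_iterate_eulerStep_le hle δ.coe_nonneg g q).trans ?_
    rw [hCdef, ← hkδ']
    gcongr
  rw [eulerApprox_eq, ← hδ, ← hkδ]
  constructor
  · refine le_trans (EReal.coe_le_coe_iff.2 (le_of_eq ?_))
      (le_upperExpectation hle s δ k g (η := (8 * hi * C * Δ + 1) / k) (by positivity) ?_ ω)
    · rw [hkδ, hkδ']
      ring
    · intro q hq
      calc 4 * δ * ‖generator lo hi ((eulerStep lo hi δ)^[q] g)‖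
          ≤ 4 * δ * (2 * hi * C) := by
            gcongr
            exact (norm_generator_le hle _).trans (by gcongr; exact hnorm q hq)
        _ = 8 * hi * C * Δ / k := by rw [hδ']; ring
        _ ≤ _ := by gcongr; linarith
  · refine (upperExpectation_le hle s δ k g hC hnorm ω).trans (EReal.coe_le_coe_iff.2 ?_)
    gcongr
    rw [hkδ, le_div_iff₀ hk0']
    have e : (k : ℝ) * (4 * hi * C * δ * hi * δ) * k = hi * Δ * (4 * hi * C * Δ) := by
      rw [← hkδ']; ring
    rw [e]
    have : 0 ≤ hi * C * Δ := by positivity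
    gcongr
    linarith

/-! ### Convergence of the Euler approximations -/

/-- Any two Euler approximations are close to each other, as both are close to the same upper
expectation. -/
theorem exists_dist_eulerApprox_le {lo hi : ℝ≥0} (hle : lo ≤ hi) (Δ : ℝ≥0) (R : ℝ) :
    ∃ M : ℝ, 0 ≤ M ∧ ∀ (g : ℕ →ᵇ ℝ), ‖g‖ ≤ R → ∀ k l : ℕ, 1 ≤ k → 1 ≤ l →
      dist (eulerApprox lo hi Δ k g) (eulerApprox lo hi Δ l g) ≤ M / k + M / l := by
  obtain ⟨M, hM, h⟩ := exists_upperExpectation_bounds hle Δ R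
  refine ⟨M, hM, fun g hg k l hk hl => ?_⟩
  refine (BoundedContinuousFunction.dist_le (by positivity)).2 fun n => ?_
  -- Every state `n` is the value of some path at time `1`.
  obtain ⟨ω, rfl⟩ := CountingPath.exists_apply_eq one_pos n
  obtain ⟨h1, h2⟩ := h g hg 1 ω k hk
  obtain ⟨h3, h4⟩ := h g hg 1 ω l hl
  have h5 := EReal.coe_le_coe_iff.1 (h1.trans h4)
  have h6 := EReal.coe_le_coe_iff.1 (h3.trans h2)
  rw [Real.dist_eq, abs_le]
  constructor <;> linarith

theorem exists_dist_semigroup_le {lo hi : ℝ≥0} (hle : lo ≤ hi) (Δ : ℝ≥0) (R : ℝ) :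
    ∃ M : ℝ, ∀ (g : ℕ →ᵇ ℝ), ‖g‖ ≤ R → ∀ k : ℕ, 1 ≤ k →
      dist (eulerApprox lo hi Δ k g) (semigroup lo hi Δ g) ≤ M / k := by
  obtain ⟨M, hM, h⟩ := exists_dist_eulerApprox_le hle Δ R
  refine ⟨M, fun g hg k hk => ?_⟩
  have hlim : Tendsto (fun l : ℕ => M / (l : ℝ)) atTop (𝓝 0) :=
    tendsto_const_div_atTop_nhds_zero_nat M
  have hcauchy : CauchySeq fun l : ℕ => eulerApprox lo hi Δ l g := by
    refine Metric.cauchySeq_iff.2 fun ε hε => ?_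
    obtain ⟨N, hN⟩ := eventually_atTop.1
      ((hlim.eventually (gt_mem_nhds (half_pos hε))).and (eventually_ge_atTop 1))
    refine ⟨N, fun m hm n hn => (h g hg m n (hN m hm).2 (hN n hn).2).trans_lt ?_⟩
    linarith [(hN m hm).1, (hN n hn).1]
  have hS : Tendsto (fun l : ℕ => eulerApprox lo hi Δ l g) atTop (𝓝 (semigroup lo hi Δ g)) :=
    tendsto_nhds_limUnder (cauchySeq_tendsto_of_complete hcauchy)
  refine le_of_tendsto_of_tendsto (tendsto_const_nhds.dist hS) (b := atTop)
    (g := fun l : ℕ => M / (k : ℝ) + M / (l : ℝ)) ?_ ?_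
  · simpa using hlim.const_add (M / (k : ℝ))
  · filter_upwards [eventually_ge_atTop 1] with l hl
    exact h g hg k l hk hl

theorem tendstoUniformlyOn_eulerApprox {lo hi : ℝ≥0} (hle : lo ≤ hi) (Δ : ℝ≥0) (R : ℝ) :
    TendstoUniformlyOn (fun (k : ℕ) (g : ℕ →ᵇ ℝ) => eulerApprox lo hi Δ k g)
      (semigroup lo hi Δ) atTop (Metric.closedBall 0 R) := by
  obtain ⟨M, h⟩ := exists_dist_semigroup_le hle Δ R
  refine Metric.tendstoUniformlyOn_iff.2 fun ε hε => ?_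
  have hlim : Tendsto (fun l : ℕ => M / (l : ℝ)) atTop (𝓝 0) :=
    tendsto_const_div_atTop_nhds_zero_nat M
  filter_upwards [hlim.eventually (gt_mem_nhds hε), eventually_ge_atTop 1] with k hk hk1 g hg
  rw [dist_comm]
  exact (h g (by simpa using hg) k hk1).trans_lt hk

theorem upperExpectation_eq_semigroup {lo hi : ℝ≥0} (hle : lo ≤ hi) (s Δ : ℝ≥0) (g : ℕ →ᵇ ℝ)
    (ω : CountingPath) :
    upperExpectation (oneSidedCapitalProcesses lo hi) (fun _ => (s : ℝ≥0∞))
        (fun ϖ => ((g (coord (s + Δ) ϖ) : ℝ) : EReal)) ω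
      = ((semigroup lo hi Δ g (ω s) : ℝ) : EReal) := by
  obtain ⟨M, -, h⟩ := exists_upperExpectation_bounds hle Δ ‖g‖
  obtain ⟨M', h'⟩ := exists_dist_semigroup_le hle Δ ‖g‖
  have hlim : ∀ M : ℝ, Tendsto (fun l : ℕ => M / (l : ℝ)) atTop (𝓝 0) :=
    tendsto_const_div_atTop_nhds_zero_nat
  have hval : Tendsto (fun k : ℕ => eulerApprox lo hi Δ k g (ω s)) atTop
      (𝓝 (semigroup lo hi Δ g (ω s))) := by
    refine tendsto_iff_dist_tendsto_zero.2 (squeeze_zero' (.of_forall fun _ => dist_nonneg) ?_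
      (hlim M'))
    filter_upwards [eventually_ge_atTop 1] with k hk
    exact (BoundedContinuousFunction.dist_coe_le_dist _).trans (h' g le_rfl k hk)
  have hadd : Tendsto (fun k : ℕ => ((eulerApprox lo hi Δ k g (ω s) + M / k : ℝ) : EReal)) atTop
      (𝓝 ((semigroup lo hi Δ g (ω s) : ℝ) : EReal)) :=
    (continuous_coe_real_ereal.tendsto _).comp (by simpa using hval.add (hlim M))
  have hsub : Tendsto (fun k : ℕ => ((eulerApprox lo hi Δ k g (ω s) - M / k : ℝ) : EReal)) atTop
      (𝓝 ((semigroup lo hi Δ g (ω s) : ℝ) : EReal)) :=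
    (continuous_coe_real_ereal.tendsto _).comp (by simpa using hval.sub (hlim M))
  refine le_antisymm (ge_of_tendsto hadd ?_) (le_of_tendsto hsub ?_)
  · filter_upwards [eventually_ge_atTop 1] with k hk using (h g le_rfl s ω k hk).2
  · filter_upwards [eventually_ge_atTop 1] with k hk using (h g le_rfl s ω k hk).1

end ImprecisePoisson

/-- The first conjunct says that the limit defining the semigroup exists, in the operator norm
(for positively homogeneous operators: uniformly on bounded sets of functions). -/
theorem mainTheorem1 (lo hi : ℝ≥0) (hle : lo ≤ hi) :
    (∀ (Δ : ℝ≥0) (r : ℝ),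
      TendstoUniformlyOn (fun (k : ℕ) (g : ℕ →ᵇ ℝ) => ImprecisePoisson.eulerApprox lo hi Δ k g)
        (ImprecisePoisson.semigroup lo hi Δ) atTop (Metric.closedBall 0 r)) ∧
    ∀ (s t : ℝ≥0), s ≤ t → ∀ (g : ℕ →ᵇ ℝ) (ω : ImprecisePoisson.CountingPath),
      ImprecisePoisson.upperExpectation (ImprecisePoisson.oneSidedCapitalProcesses lo hi)
          (fun _ => (s : ℝ≥0∞))
          (fun ϖ => ((g (ImprecisePoisson.coord t ϖ) : ℝ) : EReal)) ω
        = ((ImprecisePoisson.semigroup lo hi (t - s) g (ImprecisePoisson.coord s ω) : ℝ) : EReal) := by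
  refine ⟨ImprecisePoisson.tendstoUniformlyOn_eulerApprox hle, fun s t hst g ω => ?_⟩
  have h := ImprecisePoisson.upperExpectation_eq_semigroup hle s (t - s) g ω
  rwa [add_tsub_cancel_of_le hst] at h
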